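/- Let $\mathcal V,\mathcal X$ be finite-dimensional real normed spaces ($\mathcal V$ Euclidean), $\alpha\in(1/3,1/2]$, and let $\mathbf W=(W,\mathbb W)$ be an $\alpha$-Hölder rough path on $[0,1]$ with values in $\mathcal V$, i.e. $W\in C^{\alpha}([0,1];\mathcal V)$, $|\mathbb W_{s,t}|\le C|t-s|^{2\alpha}$ with $\mathbb W_{s,t}\in \mathcal V\otimes\mathcal V$, and $\mathbb W_{s,t}-\mathbb W_{s,u}-\mathbb W_{u,t}=(W_u-W_s)\otimes(W_t-W_u)$ for all $s,u,t\in[0,1]$. Let $D^{2\alpha}_W([0,1];\mathcal X)$ be the space of controlled rough paths, i.e. of pairs $(Y,Y')$ with $Y\in C^\alpha([0,1];\mathcal X)$, $Y'\in C^\alpha([0,1];\mathcal L(\mathcal V,\mathcal X))$ and $|R^Y_{s,t}|\le C|t-s|^{2\alpha}$, where $R^Y_{s,t}=Y_t-Y_s-Y'_s(W_t-W_s)$. Let $\|\cdot\|_{\mathbf D^{2\alpha}_W}$ be either of the two equivalent norms $$|Y_0|+|Y'_0|+\|Y'\|_\alpha+\|R^Y\|_{2\alpha}\qquad\text{or}\qquad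 \|Y\|_\infty+\|Y'\|_\infty+\|Y'\|_\alpha+\|R^Y\|_{2\alpha}$$ ($\|\cdot\|_\alpha,\|\cdot\|_{2\alpha}$ the Hölder semi-norms). Let $A\in\mathcal L(\mathcal X)$ and $S(t)=e^{tA}$. Let $F:\mathcal X\to\mathcal X$ be $C^1$ with bounded derivative and $F(0)=DF(0)=0$, and let $G:\mathcal X\to\mathcal L(\mathcal V,\mathcal X)$ be $C^3$ with bounded derivatives of orders $1,2,3$ and $G(0)=DG(0)=D^2G(0)=0$. Let $f:[0,\infty)\to[0,1]$ be a $C^3$ function with $f=1$ on $[0,1/2]$ and $f=0$ on $[1,\infty)$. For $R>0$ and $(Y,Y')\in D^{2\alpha}_W([0,1];\mathcal X)$ put $\rho=f(\|Y,Y'\|_{\mathbf D^{2\alpha}_W}/R)$ and $$\chi_R(Y)=\rho\,Y,\quad (\chi_R(Y))'=\rho\,Y',\quad F_R(Y)(t)=F(\chi_R(Y)_t),\quad G_R(Y)(t)=G(\chi_R(Y)_t),$$ where $G_R(Y)$ has Gubinelli derivative $DG(\chi_R(Y))(\chi_R(Y))'$, and $$T_R(Y,Y')=\Big(\int_0^{\cdot}S(\cdot-r)F_R(Y)(r)\,dr+\int_0^{\cdot}S(\cdot-r)G_R(Y)(r)\,d\mathbf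 W_r,\; G_R(Y)\Big).$$ Here, for a controlled rough path $(Z,Z')\in D^{2\alpha}_W([0,1];\mathcal L(\mathcal V,\mathcal X))$, $\int_s^tZ_r\,d\mathbf W_r$ is the limit of $\sum_{[u,v]\in\mathcal P}\big(Z_u(W_v-W_u)+Z'_u\mathbb W_{u,v}\big)$ over partitions $\mathcal P$ of $[s,t]$ with mesh $|\mathcal P|\to0$, and $r\mapsto S(t-r)G_R(Y)(r)$ has Gubinelli derivative $S(t-r)(G_R(Y))'(r)$. Then: 1. For every $R>0$ and every $(Y,Y')\in D^{2\alpha}_W([0,1];\mathcal X)$, the drift integrands are integrable, for every $t\in[0,1]$ the pair $\big(S(t-\cdot)G_R(Y),S(t-\cdot)(G_R(Y))'\big)$ belongs to $D^{2\alpha}_W([0,1];\mathcal L(\mathcal V,\mathcal X))$ and its rough integral over $[0,t]$ exists, and $T_R(Y,Y')\in D^{2\alpha}_W([0,1];\mathcal X)$. 2. There is $R_0>0$ such that for every $R\in(0,R_0]$: (a) $T_R$ is a contraction on $D^{2\alpha}_W([0,1];\mathcal X)$: there is $K\in[0,1)$ with $\|T_R(Y,Y')-T_R(\widetilde Y,\widetilde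 Y')\|_{\mathbf D^{2\alpha}_W}\le K\|Y-\widetilde Y,Y'-\widetilde Y'\|_{\mathbf D^{2\alpha}_W}$ for all $(Y,Y'),(\widetilde Y,\widetilde Y')\in D^{2\alpha}_W([0,1];\mathcal X)$; (b) $T_R$ has a unique fixed point in $D^{2\alpha}_W([0,1];\mathcal X)$; (c) for every $\xi\in\mathcal X$ the truncated rough differential equation with initial value $\xi$ has a unique mild solution, i.e. there is a unique $(U,U')\in D^{2\alpha}_W([0,1];\mathcal X)$ with $(U,U')=(S(\cdot)\xi,0)+T_R(U,U')$. -/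

import Mathlib

open scoped NNReal TensorProduct unitInterval

noncomputable section

namespace RoughCutoff

section Spaces

variable {V X : Type*}
  [NormedAddCommGroup V] [InnerProductSpace ℝ V]
  [NormedAddCommGroup X] [NormedSpace ℝ X]

/-- `‖Ξ s t‖ ≤ C |t - s| ^ β` on `[0,1]²` for some constant `C`. -/
def MemHolderTwo {E : Type*} [NormedAddCommGroup E] (β : ℝ) (Ξ : I → I → E) : Prop :=
  ∃ C : ℝ, ∀ s t : I, ‖Ξ s t‖ ≤ C * |(t : ℝ) - s| ^ β

/-- The two-parameter Hölder semi-norm `sup_{s ≠ t} ‖Ξ s t‖ / |t - s| ^ β`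
(the diagonal contributes `0`). -/
def holderTwo {E : Type*} [NormedAddCommGroup E] (β : ℝ) (Ξ : I → I → E) : ℝ :=
  ⨆ p : I × I, ‖Ξ p.1 p.2‖ / |(p.2 : ℝ) - p.1| ^ β

/-- An `α`-Hölder rough path `(W, 𝕎)` over `[0,1]` with values in `V`. -/
structure RoughPath (α : ℝ≥0) (V : Type*) [NormedAddCommGroup V] [InnerProductSpace ℝ V] where
  /-- the path `W` -/
  path : I → V
  /-- the second order process `𝕎` -/
  area : I → I → V ⊗[ℝ] V
  path_holder : MemHolder α path
  area_holder : MemHolderTwo (2 * α) area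
  /-- Chen's relation -/
  chen : ∀ s u t : I,
    area s t - area s u - area u t = (path u - path s) ⊗ₜ[ℝ] (path t - path u)

/-- Pairs `(Y, Y')` of a path in `X` and a path in `L(V, X)`. -/
abbrev PathPair (V X : Type*) [NormedAddCommGroup V] [InnerProductSpace ℝ V]
    [NormedAddCommGroup X] [NormedSpace ℝ X] : Type _ :=
  (I → X) × (I → V →L[ℝ] X)

/-- The remainder `R^Y_{s,t} = Y_t - Y_s - Y'_s (W_t - W_s)`. -/
def remainder (W : I → V) (Y : PathPair V X) (s t : I) : X :=
  Y.1 t - Y.1 s - Y.2 s (W t - W s)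

/-- The space `D^{2α}_W([0,1]; X)` of controlled rough paths `(Y, Y')`. -/
def controlled (α : ℝ≥0) (W : I → V) : Set (PathPair V X) :=
  {Y | MemHolder α Y.1 ∧ MemHolder α Y.2 ∧ MemHolderTwo (2 * α) (remainder W Y)}

/-- The semi-norm `‖Y'‖_α + ‖R^Y‖_{2α}`. -/
def crpSeminorm (α : ℝ≥0) (W : I → V) (Y : PathPair V X) : ℝ :=
  nnHolderNorm α Y.2 + holderTwo (2 * α) (remainder W Y)

/-- The norm `|Y_0| + |Y'_0| + ‖Y'‖_α + ‖R^Y‖_{2α}`. -/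
def crpNorm (α : ℝ≥0) (W : I → V) (Y : PathPair V X) : ℝ :=
  ‖Y.1 0‖ + ‖Y.2 0‖ + crpSeminorm α W Y

/-- The norm `‖Y‖_∞ + ‖Y'‖_∞ + ‖Y'‖_α + ‖R^Y‖_{2α}`. -/
def crpSupNorm (α : ℝ≥0) (W : I → V) (Y : PathPair V X) : ℝ :=
  (⨆ t : I, ‖Y.1 t‖) + (⨆ t : I, ‖Y.2 t‖) + crpSeminorm α W Y

end Spaces

section Integral

variable {V X : Type*}
  [NormedAddCommGroup V] [InnerProductSpace ℝ V]
  [NormedAddCommGroup X] [NormedSpace ℝ X]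

/-- A map in `L(V, L(V, X))` applied to a tensor: `B (v ⊗ w) = B v w`. -/
def applyTensor (B : V →L[ℝ] V →L[ℝ] X) : V ⊗[ℝ] V →ₗ[ℝ] X :=
  TensorProduct.lift ((ContinuousLinearMap.coeLM ℝ).comp (B : V →ₗ[ℝ] V →L[ℝ] X))

/-- A partition `s = t_0 < t_1 < ⋯ < t_n = t` of `[s,t] ⊆ [0,1]`. -/
structure Partition (s t : I) where
  n : ℕ
  pt : Fin (n + 1) → I
  strictMono : StrictMono pt
  pt_zero : pt 0 = s
  pt_last : pt (Fin.last n) = t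

/-- The compensated Riemann sum `∑ (Y_u W_{u,v} + Y'_u 𝕎_{u,v})` over the intervals `[u,v]` of
a partition. -/
def compensatedSum {α : ℝ≥0} (W : RoughPath α V) (Y : PathPair V (V →L[ℝ] X)) {s t : I}
    (P : Partition s t) : X :=
  ∑ i : Fin P.n,
    (Y.1 (P.pt i.castSucc) (W.path (P.pt i.succ) - W.path (P.pt i.castSucc)) +
      applyTensor (Y.2 (P.pt i.castSucc)) (W.area (P.pt i.castSucc) (P.pt i.succ)))

/-- `J` is the limit of the compensated Riemann sums over partitions of `[s,t]` as the mesh tends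
to `0`. -/
def IsRoughIntegral {α : ℝ≥0} (W : RoughPath α V) (Y : PathPair V (V →L[ℝ] X)) (s t : I)
    (J : X) : Prop :=
  ∀ ε : ℝ, 0 < ε → ∃ δ : ℝ, 0 < δ ∧ ∀ P : Partition s t,
    (∀ i : Fin P.n, (P.pt i.succ : ℝ) - P.pt i.castSucc < δ) → ‖compensatedSum W Y P - J‖ < ε

open Classical in
/-- The rough integral `∫_s^t Y_r d𝐖_r` (for `s ≤ t`); `0` if the limit does not exist. -/
def roughIntegral {α : ℝ≥0} (W : RoughPath α V) (Y : PathPair V (V →L[ℝ] X)) (s t : I) : X :=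
  if h : ∃ J, IsRoughIntegral W Y s t J then h.choose else 0

end Integral

section Equation

variable {V X : Type*}
  [NormedAddCommGroup V] [InnerProductSpace ℝ V]
  [NormedAddCommGroup X] [NormedSpace ℝ X]

/-- The group `S(t) = exp(tA)`. -/
def sg (A : X →L[ℝ] X) (t : ℝ) : X →L[ℝ] X := NormedSpace.exp (t • A)

/-- `m`-times continuously differentiable maps whose derivatives of order `1, …, m` are bounded
(boundedness of the map itself is not required). -/
def BoundedDerivs {E E' : Type*} [NormedAddCommGroup E] [NormedSpace ℝ E]
    [NormedAddCommGroup E'] [NormedSpace ℝ E'] (m : ℕ) (H : E → E') : Prop :=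
  ContDiff ℝ m H ∧ ∀ k : ℕ, 1 ≤ k → k ≤ m → ∃ C : ℝ, ∀ x, ‖iteratedFDeriv ℝ k H x‖ ≤ C

/-- `f : [0,∞) → [0,1]` is `C³`, equals `1` on `[0,1/2]` and `0` on `[1,∞)`. Such an `f` is
Lipschitz with bounded derivatives, since it is constant off a compact interval. Values at
negative arguments play no role. -/
structure IsCutoff (f : ℝ → ℝ) : Prop where
  contDiffOn : ContDiffOn ℝ 3 f (Set.Ici 0)
  mem_Icc : ∀ x, 0 ≤ x → f x ∈ Set.Icc (0 : ℝ) 1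
  eq_one : ∀ x, 0 ≤ x → x ≤ 1 / 2 → f x = 1
  eq_zero : ∀ x, 1 ≤ x → f x = 0

/-- The cut-off `χ_R(Y, Y') = (Y f(N(Y,Y')/R), Y' f(N(Y,Y')/R))` at the level of paths, for a norm
`N` on controlled rough paths. -/
def cutoff (N : PathPair V X → ℝ) (f : ℝ → ℝ) (R : ℝ) (Y : PathPair V X) : PathPair V X :=
  f (N Y / R) • Y

/-- The composition `(G(Y), DG(Y) Y')`. -/
def compose (G : X → V →L[ℝ] X) (Y : PathPair V X) : PathPair V (V →L[ℝ] X) :=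
  (fun t => G (Y.1 t), fun t => (fderiv ℝ G (Y.1 t)).comp (Y.2 t))

/-- The pair `(S(t-·) Z, S(t-·) Z')`. -/
def shifted (A : X →L[ℝ] X) (t : I) (Z : PathPair V (V →L[ℝ] X)) : PathPair V (V →L[ℝ] X) :=
  (fun r => (sg A ((t : ℝ) - r)).comp (Z.1 r),
   fun r => (ContinuousLinearMap.compL ℝ V X X (sg A ((t : ℝ) - r))).comp (Z.2 r))

/-- The integrand `r ↦ S(t-r) F(Y_r)`, where `Y` is extended from `[0,1]` to `ℝ` by constants. -/
def driftIntegrand (A : X →L[ℝ] X) (F : X → X) (Y : I → X) (t : I) (r : ℝ) : X :=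
  sg A ((t : ℝ) - r) (F (Y (Set.projIcc 0 1 zero_le_one r)))

/-- The drift convolution `∫_0^t S(t-r) F(Y_r) dr`. -/
def driftConv (A : X →L[ℝ] X) (F : X → X) (Y : I → X) (t : I) : X :=
  ∫ r in (0 : ℝ)..t, driftIntegrand A F Y t r

/-- The rough convolution `∫_0^t S(t-r) Z_r d𝐖_r`. -/
def roughConv {α : ℝ≥0} (W : RoughPath α V) (A : X →L[ℝ] X) (Z : PathPair V (V →L[ℝ] X))
    (t : I) : X :=
  roughIntegral W (shifted A t Z) 0 t

/-- The map
`T_R(Y,Y') = (∫_0^· S(·-r) F(χ_R(Y)_r) dr + ∫_0^· S(·-r) G(χ_R(Y)_r) d𝐖_r, G(χ_R(Y)))`. -/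
def mildMap {α : ℝ≥0} (W : RoughPath α V) (A : X →L[ℝ] X) (F : X → X) (G : X → V →L[ℝ] X)
    (N : PathPair V X → ℝ) (f : ℝ → ℝ) (R : ℝ) (Y : PathPair V X) : PathPair V X :=
  (fun t => driftConv A F (cutoff N f R Y).1 t + roughConv W A (compose G (cutoff N f R Y)) t,
   (compose G (cutoff N f R Y)).1)

/-- The pair `(S(·)ξ, 0)`. -/
def initialPair (A : X →L[ℝ] X) (ξ : X) : PathPair V X := (fun t => sg A t ξ, 0)

end Equation

end RoughCutoff

end

/-!
The cut-off map `χ_R` is Lipschitz with a constant independent of `R` and takes its values in the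
ball of radius `R`. On paths in that ball the composition with `F` has a Lipschitz constant
`ε(R) → 0`, because `DF(0) = 0`, and the composition with `G` has a Lipschitz constant `O(R²)`,
because `G` vanishes to third order at `0`. The sewing lemma makes `Z ↦ ∫ Z d𝐖` bounded on
controlled paths, and writing `S(t - r) = S(t) S(-r)` turns each convolution into the
multiplication of an ordinary or rough integral by the smooth path `S`, so the mild integral is
bounded too. Hence `T_R` has Lipschitz constant at most `C (ε(R) + R²)`, which is small when `R` is
small, and Banach's fixed point theorem applies on the complete space of controlled paths.
-/

noncomputable section

namespace RoughCutoff

/-! ### Controlled paths and their norms -/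

section Holder

variable {E : Type*} [NormedAddCommGroup E]

lemma abs_sub_le_one (s t : I) : |(t : ℝ) - s| ≤ 1 := by
  rw [abs_le]
  constructor <;> linarith [s.2.1, s.2.2, t.2.1, t.2.2]

lemma abs_sub_rpow_le_one (s t : I) {β : ℝ} (hβ : 0 ≤ β) : |(t : ℝ) - s| ^ β ≤ 1 :=
  Real.rpow_le_one (abs_nonneg _) (abs_sub_le_one s t) hβ

lemma abs_sub_rpow_le_rpow (s t : I) {β γ : ℝ} (hβ : 0 ≤ β) (hβγ : β ≤ γ) :
    |(t : ℝ) - s| ^ γ ≤ |(t : ℝ) - s| ^ β :=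
  Real.rpow_le_rpow_of_exponent_ge' (abs_nonneg _) (abs_sub_le_one s t) hβ hβγ

lemma holderWith_iff {C α : ℝ≥0} {f : I → E} :
    HolderWith C α f ↔ ∀ s t : I, ‖f t - f s‖ ≤ C * |(t : ℝ) - s| ^ (α : ℝ) := by
  refine ⟨fun h s t => ?_, fun h s t => ?_⟩
  · simpa only [dist_eq_norm, Subtype.dist_eq, Real.norm_eq_abs] using h.dist_le t s
  · have hts := h t s
    rw [← dist_eq_norm, ← Real.dist_eq, ← Subtype.dist_eq, dist_nndist, dist_nndist] at hts
    rw [edist_nndist, edist_nndist, ← ENNReal.coe_rpow_of_nonneg _ α.coe_nonneg,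
      ← ENNReal.coe_mul, ENNReal.coe_le_coe]
    exact_mod_cast hts

lemma memHolder_of_norm_sub_le {α : ℝ≥0} {f : I → E} {C : ℝ}
    (h : ∀ s t : I, ‖f t - f s‖ ≤ C * |(t : ℝ) - s| ^ (α : ℝ)) : MemHolder α f := by
  refine ⟨C.toNNReal, holderWith_iff.2 fun s t => (h s t).trans ?_⟩
  gcongr
  exact Real.le_coe_toNNReal C

lemma nnHolderNorm_le_of_norm_sub_le {α : ℝ≥0} {f : I → E} {C : ℝ} (hC : 0 ≤ C)
    (h : ∀ s t : I, ‖f t - f s‖ ≤ C * |(t : ℝ) - s| ^ (α : ℝ)) : nnHolderNorm α f ≤ C := by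
  lift C to ℝ≥0 using hC
  exact_mod_cast (holderWith_iff.2 h).nnholderNorm_le

lemma norm_sub_le_nnHolderNorm {α : ℝ≥0} {f : I → E} (hf : MemHolder α f) (s t : I) :
    ‖f t - f s‖ ≤ nnHolderNorm α f * |(t : ℝ) - s| ^ (α : ℝ) :=
  holderWith_iff.1 hf.holderWith s t

lemma bddAbove_range_norm_of_memHolder {α : ℝ≥0} {f : I → E} (hf : MemHolder α f) :
    BddAbove (Set.range fun t => ‖f t‖) := by
  refine ⟨‖f 0‖ + nnHolderNorm α f, Set.forall_mem_range.2 fun t => ?_⟩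
  calc ‖f t‖ ≤ ‖f 0‖ + ‖f t - f 0‖ := norm_le_norm_add_norm_sub' _ _
    _ ≤ ‖f 0‖ + nnHolderNorm α f := by
      gcongr
      exact (norm_sub_le_nnHolderNorm hf 0 t).trans
        (mul_le_of_le_one_right (NNReal.coe_nonneg _) (abs_sub_rpow_le_one 0 t α.2))

lemma holderTwo_nonneg (β : ℝ) (Ξ : I → I → E) : 0 ≤ holderTwo β Ξ :=
  Real.iSup_nonneg fun _ => by positivity

lemma holderTwo_le_of_norm_le {β : ℝ} {Ξ : I → I → E} {C : ℝ} (hC : 0 ≤ C)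
    (h : ∀ s t : I, ‖Ξ s t‖ ≤ C * |(t : ℝ) - s| ^ β) : holderTwo β Ξ ≤ C :=
  ciSup_le fun p => div_le_of_le_mul₀ (by positivity) hC (h p.1 p.2)

lemma bddAbove_range_of_memHolderTwo {β : ℝ} {Ξ : I → I → E} (h : MemHolderTwo β Ξ) :
    BddAbove (Set.range fun p : I × I => ‖Ξ p.1 p.2‖ / |(p.2 : ℝ) - p.1| ^ β) := by
  obtain ⟨C, hC⟩ := h
  refine ⟨max C 0, Set.forall_mem_range.2 fun p => ?_⟩
  refine div_le_of_le_mul₀ (by positivity) (le_max_right _ _) ((hC _ _).trans ?_)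
  gcongr
  exact le_max_left _ _

lemma norm_le_holderTwo {β : ℝ} (hβ : β ≠ 0) {Ξ : I → I → E} (h : MemHolderTwo β Ξ) (s t : I) :
    ‖Ξ s t‖ ≤ holderTwo β Ξ * |(t : ℝ) - s| ^ β := by
  rcases eq_or_ne s t with rfl | hst
  · obtain ⟨C, hC⟩ := h
    simpa [Real.zero_rpow hβ] using hC s s
  · have : 0 < |(t : ℝ) - s| := abs_pos.2 (sub_ne_zero.2 fun h => hst (Subtype.ext h.symm))
    rw [← div_le_iff₀ (by positivity)]
    exact le_ciSup (bddAbove_range_of_memHolderTwo h) (s, t)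

end Holder

section ControlledPaths

variable {V X : Type*} [NormedAddCommGroup V] [InnerProductSpace ℝ V]
  [NormedAddCommGroup X] [NormedSpace ℝ X] {α w : ℝ≥0} {W : I → V} {Y Z : PathPair V X}

/-- A quantitative version of `Y ∈ controlled α W`: a single constant `M` bounds the path, its
Gubinelli derivative, the Hölder semi-norm of the derivative and that of the remainder. -/
structure ControlledWith (M : ℝ) (α : ℝ≥0) (W : I → V) (Y : PathPair V X) : Prop where
  path : ∀ t, ‖Y.1 t‖ ≤ M
  deriv : ∀ t, ‖Y.2 t‖ ≤ M
  deriv_sub : ∀ s t : I, ‖Y.2 t - Y.2 s‖ ≤ M * |(t : ℝ) - s| ^ (α : ℝ)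
  remainder : ∀ s t : I, ‖remainder W Y s t‖ ≤ M * |(t : ℝ) - s| ^ (2 * (α : ℝ))

lemma remainder_add (W : I → V) (Y Z : PathPair V X) (s t : I) :
    remainder W (Y + Z) s t = remainder W Y s t + remainder W Z s t := by
  simp only [remainder, Prod.fst_add, Prod.snd_add, Pi.add_apply, add_apply]
  abel

lemma remainder_smul (W : I → V) (c : ℝ) (Y : PathPair V X) (s t : I) :
    remainder W (c • Y) s t = c • remainder W Y s t := by
  simp [remainder, smul_sub]

lemma sub_eq_deriv_add_remainder (W : I → V) (Y : PathPair V X) (s t : I) :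
    Y.1 t - Y.1 s = Y.2 s (W t - W s) + remainder W Y s t := by
  simp [remainder]

/-- The space `D^{2α}_W([0,1]; X)` as a subspace of all pairs of paths. -/
def controlledSubmodule (α : ℝ≥0) (W : I → V) : Submodule ℝ (PathPair V X) where
  carrier := controlled α W
  add_mem' := by
    rintro Y Z ⟨hY, hY', C, hRY⟩ ⟨hZ, hZ', C', hRZ⟩
    refine ⟨hY.add hZ, hY'.add hZ', C + C', fun s t => ?_⟩
    rw [remainder_add, add_mul]
    exact norm_add_le_of_le (hRY s t) (hRZ s t)
  zero_mem' := ⟨memHolder_zero, memHolder_zero, 0, fun s t => by simp [remainder]⟩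
  smul_mem' := by
    rintro c Y ⟨hY, hY', C, hRY⟩
    refine ⟨hY.smul, hY'.smul, |c| * C, fun s t => ?_⟩
    rw [remainder_smul, norm_smul, mul_assoc]
    exact mul_le_mul_of_nonneg_left (hRY s t) (abs_nonneg c)

lemma add_mem_controlled (hY : Y ∈ controlled α W) (hZ : Z ∈ controlled α W) :
    Y + Z ∈ controlled α W :=
  (controlledSubmodule α W).add_mem hY hZ

lemma sub_mem_controlled (hY : Y ∈ controlled α W) (hZ : Z ∈ controlled α W) :
    Y - Z ∈ controlled α W :=
  (controlledSubmodule α W).sub_mem (x := Y) (y := Z) hY hZ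

lemma smul_mem_controlled (c : ℝ) (hY : Y ∈ controlled α W) : c • Y ∈ controlled α W :=
  (controlledSubmodule α W).smul_mem c hY

namespace ControlledWith

variable {M M' : ℝ}

lemma nonneg (h : ControlledWith M α W Y) : 0 ≤ M := (norm_nonneg _).trans (h.path 0)

lemma mono (h : ControlledWith M α W Y) (hM : M ≤ M') : ControlledWith M' α W Y where
  path t := (h.path t).trans hM
  deriv t := (h.deriv t).trans hM
  deriv_sub s t := (h.deriv_sub s t).trans (by gcongr)
  remainder s t := (h.remainder s t).trans (by gcongr)

lemma add (hY : ControlledWith M α W Y) (hZ : ControlledWith M' α W Z) :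
    ControlledWith (M + M') α W (Y + Z) where
  path t := norm_add_le_of_le (hY.path t) (hZ.path t)
  deriv t := norm_add_le_of_le (hY.deriv t) (hZ.deriv t)
  deriv_sub s t := by
    rw [add_mul, Prod.snd_add, Pi.add_apply, Pi.add_apply, add_sub_add_comm]
    exact norm_add_le_of_le (hY.deriv_sub s t) (hZ.deriv_sub s t)
  remainder s t := by
    rw [add_mul, remainder_add]
    exact norm_add_le_of_le (hY.remainder s t) (hZ.remainder s t)

lemma smul (r : ℝ) (h : ControlledWith M α W Y) : ControlledWith (|r| * M) α W (r • Y) where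
  path t := (norm_smul_le r _).trans (mul_le_mul_of_nonneg_left (h.path t) (abs_nonneg r))
  deriv t := (norm_smul_le r _).trans (mul_le_mul_of_nonneg_left (h.deriv t) (abs_nonneg r))
  deriv_sub s t := by
    rw [Prod.smul_snd, Pi.smul_apply, Pi.smul_apply, ← smul_sub, mul_assoc]
    exact (norm_smul_le r _).trans (mul_le_mul_of_nonneg_left (h.deriv_sub s t) (abs_nonneg r))
  remainder s t := by
    rw [remainder_smul, mul_assoc]
    exact (norm_smul_le r _).trans (mul_le_mul_of_nonneg_left (h.remainder s t) (abs_nonneg r))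

lemma of_tendsto {u : ℕ → PathPair V X} (h : ∀ᶠ n in Filter.atTop, ControlledWith M α W (u n))
    (hpath : ∀ t, Filter.Tendsto (fun n => (u n).1 t) Filter.atTop (nhds (Y.1 t)))
    (hderiv : ∀ t, Filter.Tendsto (fun n => (u n).2 t) Filter.atTop (nhds (Y.2 t))) :
    ControlledWith M α W Y where
  path t := le_of_tendsto (hpath t).norm (h.mono fun _ h => h.path t)
  deriv t := le_of_tendsto (hderiv t).norm (h.mono fun _ h => h.deriv t)
  deriv_sub s t :=
    le_of_tendsto ((hderiv t).sub (hderiv s)).norm (h.mono fun _ h => h.deriv_sub s t)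
  remainder s t := by
    have hrem : Filter.Tendsto (fun n => RoughCutoff.remainder W (u n) s t) Filter.atTop
        (nhds (RoughCutoff.remainder W Y s t)) :=
      ((hpath t).sub (hpath s)).sub
        (((ContinuousLinearMap.apply ℝ X (W t - W s)).continuous.tendsto (Y.2 s)).comp (hderiv s))
    exact le_of_tendsto hrem.norm (h.mono fun _ h => h.remainder s t)

lemma path_sub (hW : HolderWith w α W) (h : ControlledWith M α W Y) (s t : I) :
    ‖Y.1 t - Y.1 s‖ ≤ (1 + w) * M * |(t : ℝ) - s| ^ (α : ℝ) := by
  have hlinear : ‖Y.2 s (W t - W s)‖ ≤ M * (w * |(t : ℝ) - s| ^ (α : ℝ)) :=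
    (Y.2 s).le_of_opNorm_le_of_le (h.deriv s) (holderWith_iff.1 hW s t)
  have hrem : ‖RoughCutoff.remainder W Y s t‖ ≤ M * |(t : ℝ) - s| ^ (α : ℝ) :=
    (h.remainder s t).trans (mul_le_mul_of_nonneg_left
      (abs_sub_rpow_le_rpow s t α.2 (by linarith [α.2])) h.nonneg)
  rw [sub_eq_deriv_add_remainder W]
  linarith [norm_add_le_of_le hlinear hrem]

lemma mem_controlled (hW : HolderWith w α W) (h : ControlledWith M α W Y) : Y ∈ controlled α W :=
  ⟨memHolder_of_norm_sub_le (h.path_sub hW), memHolder_of_norm_sub_le h.deriv_sub,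
    M, h.remainder⟩

lemma crpSeminorm_le (h : ControlledWith M α W Y) : crpSeminorm α W Y ≤ M + M :=
  add_le_add (nnHolderNorm_le_of_norm_sub_le h.nonneg h.deriv_sub)
    (holderTwo_le_of_norm_le h.nonneg h.remainder)

end ControlledWith

lemma crpSeminorm_nonneg (α : ℝ≥0) (W : I → V) (Y : PathPair V X) : 0 ≤ crpSeminorm α W Y :=
  add_nonneg (NNReal.coe_nonneg _) (holderTwo_nonneg _ _)

lemma crpSeminorm_add_le (hα : 0 < α) (hY : Y ∈ controlled α W) (hZ : Z ∈ controlled α W) :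
    crpSeminorm α W (Y + Z) ≤ crpSeminorm α W Y + crpSeminorm α W Z := by
  have hα2 : 2 * (α : ℝ) ≠ 0 := by positivity
  have hderiv : (nnHolderNorm α (Y + Z).2 : ℝ) ≤ nnHolderNorm α Y.2 + nnHolderNorm α Z.2 :=
    mod_cast hY.2.1.nnHolderNorm_add_le hZ.2.1
  have hrem : holderTwo (2 * α) (remainder W (Y + Z)) ≤
      holderTwo (2 * α) (remainder W Y) + holderTwo (2 * α) (remainder W Z) := by
    refine holderTwo_le_of_norm_le (add_nonneg (holderTwo_nonneg _ _) (holderTwo_nonneg _ _))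
      fun s t => ?_
    rw [remainder_add, add_mul]
    exact norm_add_le_of_le (norm_le_holderTwo hα2 hY.2.2 s t) (norm_le_holderTwo hα2 hZ.2.2 s t)
  simp only [crpSeminorm]
  linarith

lemma crpSeminorm_smul_le (hα : 0 < α) (c : ℝ) (hY : Y ∈ controlled α W) :
    crpSeminorm α W (c • Y) ≤ |c| * crpSeminorm α W Y := by
  have hα2 : 2 * (α : ℝ) ≠ 0 := by positivity
  have hderiv : (nnHolderNorm α (c • Y).2 : ℝ) ≤ |c| * nnHolderNorm α Y.2 := by
    rw [Prod.smul_snd, hY.2.1.nnHolderNorm_smul c]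
    simp
  have hrem :
      holderTwo (2 * α) (remainder W (c • Y)) ≤ |c| * holderTwo (2 * α) (remainder W Y) := by
    refine holderTwo_le_of_norm_le (mul_nonneg (abs_nonneg _) (holderTwo_nonneg _ _))
      fun s t => ?_
    rw [remainder_smul, norm_smul, mul_assoc]
    exact mul_le_mul_of_nonneg_left (norm_le_holderTwo hα2 hY.2.2 s t) (abs_nonneg c)
  simp only [crpSeminorm]
  linarith

lemma norm_path_le_of_mem_controlled (hα : 0 < α) (hW : HolderWith w α W)
    (hY : Y ∈ controlled α W) (t : I) :
    ‖Y.1 t‖ ≤ ‖Y.1 0‖ + ‖Y.2 0‖ * w + holderTwo (2 * α) (remainder W Y) := by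
  have hlinear : ‖Y.2 0 (W t - W 0)‖ ≤ ‖Y.2 0‖ * w :=
    (Y.2 0).le_opNorm_of_le ((holderWith_iff.1 hW 0 t).trans
      (mul_le_of_le_one_right w.2 (abs_sub_rpow_le_one _ _ α.2)))
  have hrem : ‖remainder W Y 0 t‖ ≤ holderTwo (2 * α) (remainder W Y) :=
    (norm_le_holderTwo (by positivity) hY.2.2 0 t).trans
      (mul_le_of_le_one_right (holderTwo_nonneg _ _) (abs_sub_rpow_le_one 0 t (by positivity)))
  have hsub : ‖Y.1 t - Y.1 0‖ ≤ ‖Y.2 0‖ * w + holderTwo (2 * α) (remainder W Y) := by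
    rw [sub_eq_deriv_add_remainder W]
    exact norm_add_le_of_le hlinear hrem
  linarith [norm_le_norm_add_norm_sub' (Y.1 t) (Y.1 0)]

lemma norm_deriv_le_of_mem_controlled (hY : Y ∈ controlled α W) (t : I) :
    ‖Y.2 t‖ ≤ ‖Y.2 0‖ + nnHolderNorm α Y.2 := by
  have hsub := (norm_sub_le_nnHolderNorm hY.2.1 0 t).trans
    (mul_le_of_le_one_right (NNReal.coe_nonneg _) (abs_sub_rpow_le_one 0 t α.2))
  linarith [norm_le_norm_add_norm_sub' (Y.2 t) (Y.2 0)]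

lemma controlledWith_of_mem_controlled (hα : 0 < α) (hY : Y ∈ controlled α W) {M : ℝ}
    (hpath : ∀ t, ‖Y.1 t‖ ≤ M) (hderiv : ∀ t, ‖Y.2 t‖ ≤ M) (hM : crpSeminorm α W Y ≤ M) :
    ControlledWith M α W Y where
  path := hpath
  deriv := hderiv
  deriv_sub s t := by
    refine (norm_sub_le_nnHolderNorm hY.2.1 s t).trans ?_
    gcongr
    exact (le_add_of_nonneg_right (holderTwo_nonneg _ _)).trans hM
  remainder s t := by
    refine (norm_le_holderTwo (by positivity) hY.2.2 s t).trans ?_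
    gcongr
    exact (le_add_of_nonneg_left (NNReal.coe_nonneg _)).trans hM

/-- What the argument needs to know about a norm `N` on `D^{2α}_W([0,1]; X)`: up to the factors
`a` and `b`, it is the smallest `M` with `ControlledWith M α W Y`. -/
structure IsControlledNorm (a b : ℝ) (α : ℝ≥0) (W : I → V) (N : PathPair V X → ℝ) : Prop where
  pos : 0 < a
  bound : ∀ Y ∈ controlled α W, ControlledWith (a * N Y) α W Y
  le : ∀ Y M, ControlledWith M α W Y → N Y ≤ b * M
  add_le : ∀ Y ∈ controlled α W, ∀ Z ∈ controlled α W, N (Y + Z) ≤ N Y + N Z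
  smul_le : ∀ (c : ℝ), ∀ Y ∈ controlled α W, N (c • Y) ≤ |c| * N Y

theorem isControlledNorm_crpNorm (hα : 0 < α) (hW : HolderWith w α W) :
    IsControlledNorm (X := X) (1 + w) 4 α W (crpNorm α W) where
  pos := by positivity
  bound Y hY := by
    have : (0 : ℝ) ≤ w := w.2
    have hseminorm := crpSeminorm_nonneg α W Y
    have hpath₀ := norm_nonneg (Y.1 0)
    have hderiv₀ := norm_nonneg (Y.2 0)
    have : 0 ≤ (nnHolderNorm α Y.2 : ℝ) := NNReal.coe_nonneg _
    have hrem := holderTwo_nonneg (2 * (α : ℝ)) (remainder W Y)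
    refine controlledWith_of_mem_controlled hα hY (fun t => ?_) (fun t => ?_) ?_
    · refine (norm_path_le_of_mem_controlled hα hW hY t).trans ?_
      simp only [crpNorm, crpSeminorm] at hseminorm ⊢
      nlinarith
    · refine (norm_deriv_le_of_mem_controlled hY t).trans ?_
      simp only [crpNorm, crpSeminorm] at hseminorm ⊢
      nlinarith
    · simp only [crpNorm]
      nlinarith
  le Y M h := by
    simp only [crpNorm]
    linarith [h.crpSeminorm_le, h.path 0, h.deriv 0]
  add_le Y hY Z hZ := by
    simp only [crpNorm, Prod.fst_add, Prod.snd_add, Pi.add_apply]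
    linarith [crpSeminorm_add_le hα hY hZ, norm_add_le (Y.1 0) (Z.1 0),
      norm_add_le (Y.2 0) (Z.2 0)]
  smul_le c Y hY := by
    simp only [crpNorm, Prod.smul_fst, Prod.smul_snd, Pi.smul_apply, norm_smul, Real.norm_eq_abs]
    linarith [crpSeminorm_smul_le hα c hY]

lemma iSup_norm_add_le {ι E : Type*} [Nonempty ι] [NormedAddCommGroup E] {f g : ι → E}
    (hf : BddAbove (Set.range fun i => ‖f i‖)) (hg : BddAbove (Set.range fun i => ‖g i‖)) :
    ⨆ i, ‖(f + g) i‖ ≤ (⨆ i, ‖f i‖) + ⨆ i, ‖g i‖ :=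
  ciSup_le fun i => norm_add_le_of_le (le_ciSup hf i) (le_ciSup hg i)

theorem isControlledNorm_crpSupNorm (hα : 0 < α) :
    IsControlledNorm (X := X) 1 4 α W (crpSupNorm α W) where
  pos := one_pos
  bound Y hY := by
    have hseminorm := crpSeminorm_nonneg α W Y
    have hpath₀ : 0 ≤ ⨆ t : I, ‖Y.1 t‖ := Real.iSup_nonneg fun _ => norm_nonneg _
    have hderiv₀ : 0 ≤ ⨆ t : I, ‖Y.2 t‖ := Real.iSup_nonneg fun _ => norm_nonneg _
    have hpath := le_ciSup (bddAbove_range_norm_of_memHolder hY.1)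
    have hderiv := le_ciSup (bddAbove_range_norm_of_memHolder hY.2.1)
    simp only [one_mul, crpSupNorm]
    refine controlledWith_of_mem_controlled hα hY (fun t => ?_) (fun t => ?_) ?_
    · linarith [hpath t]
    · linarith [hderiv t]
    · linarith
  le Y M h := by
    simp only [crpSupNorm]
    linarith [h.crpSeminorm_le, ciSup_le h.path, ciSup_le h.deriv]
  add_le Y hY Z hZ := by
    simp only [crpSupNorm, Prod.fst_add, Prod.snd_add]
    linarith [crpSeminorm_add_le hα hY hZ,
      iSup_norm_add_le (bddAbove_range_norm_of_memHolder hY.1)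
        (bddAbove_range_norm_of_memHolder hZ.1),
      iSup_norm_add_le (bddAbove_range_norm_of_memHolder hY.2.1)
        (bddAbove_range_norm_of_memHolder hZ.2.1)]
  smul_le c Y hY := by
    simp only [crpSupNorm, Prod.smul_fst, Prod.smul_snd, Pi.smul_apply, norm_smul,
      Real.norm_eq_abs, ← Real.mul_iSup_of_nonneg (abs_nonneg c)]
    linarith [crpSeminorm_smul_le hα c hY]

end ControlledPaths

/-! ### Completeness and Banach's fixed point theorem -/

section FixedPoint

open Filter Topology

lemma existsUnique_fixedPoint_of_addGroupNorm {E : Type*} [AddCommGroup E] (N : AddGroupNorm E)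
    (hN : ∀ u : ℕ → E, (∀ ε > 0, ∃ n₀, ∀ m ≥ n₀, ∀ n ≥ n₀, N (u m - u n) < ε) →
      ∃ x, ∀ ε > 0, ∃ n₀, ∀ n ≥ n₀, N (u n - x) < ε)
    (Φ : E → E) {K : ℝ} (hK0 : 0 ≤ K) (hK1 : K < 1) (hΦ : ∀ x y, N (Φ x - Φ y) ≤ K * N (x - y)) :
    ∃! x, Φ x = x := by
  let : NormedAddCommGroup E := N.toNormedAddCommGroup
  have hdist : ∀ x y : E, dist x y = N (x - y) := fun x y => dist_eq_norm x y
  have : CompleteSpace E := by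
    refine Metric.complete_of_cauchySeq_tendsto fun u hu => ?_
    rw [Metric.cauchySeq_iff] at hu
    obtain ⟨x, hx⟩ := hN u (by simpa only [hdist] using hu)
    exact ⟨x, Metric.tendsto_atTop.2 (by simpa only [hdist] using hx)⟩
  have hcontracting : ContractingWith ⟨K, hK0⟩ Φ :=
    ⟨by exact_mod_cast hK1, LipschitzWith.of_dist_le_mul fun x y => by
      rw [hdist, hdist]
      exact hΦ x y⟩
  exact ⟨hcontracting.fixedPoint, hcontracting.fixedPoint_isFixedPt,
    fun y hy => hcontracting.fixedPoint_unique hy⟩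

lemma exists_tendsto_of_norm_sub_le {E : Type*} [NormedAddCommGroup E] [CompleteSpace E]
    {u : ℕ → E} (hu : ∀ ε > 0, ∃ n₀, ∀ m ≥ n₀, ∀ n ≥ n₀, ‖u m - u n‖ ≤ ε) :
    ∃ x, Tendsto u atTop (𝓝 x) := by
  refine cauchySeq_tendsto_of_complete (Metric.cauchySeq_iff.2 fun ε hε => ?_)
  obtain ⟨n₀, hn₀⟩ := hu (ε / 2) (half_pos hε)
  exact ⟨n₀, fun m hm n hn => (dist_eq_norm (u m) (u n)).trans_lt
    ((hn₀ m hm n hn).trans_lt (half_lt_self hε))⟩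

variable {V X : Type*} [NormedAddCommGroup V] [InnerProductSpace ℝ V]
  [NormedAddCommGroup X] [NormedSpace ℝ X]
  {α w : ℝ≥0} {W : I → V} {a b : ℝ} {N : PathPair V X → ℝ}

lemma exists_limit_of_controlledWith [CompleteSpace X] {u : ℕ → PathPair V X}
    (hu : ∀ ε > 0, ∃ n₀, ∀ m ≥ n₀, ∀ n ≥ n₀, ControlledWith ε α W (u m - u n)) :
    ∃ Y, ∀ ε > 0, ∃ n₀, ∀ n ≥ n₀, ControlledWith ε α W (u n - Y) := by
  have hpath (t : I) : ∃ y, Tendsto (fun n => (u n).1 t) atTop (𝓝 y) :=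
    exists_tendsto_of_norm_sub_le fun ε hε =>
      (hu ε hε).imp fun _ h m hm n hn => (h m hm n hn).path t
  have hderiv (t : I) : ∃ y, Tendsto (fun n => (u n).2 t) atTop (𝓝 y) :=
    exists_tendsto_of_norm_sub_le fun ε hε =>
      (hu ε hε).imp fun _ h m hm n hn => (h m hm n hn).deriv t
  choose path hpath using hpath
  choose deriv hderiv using hderiv
  refine ⟨(path, deriv), fun ε hε => (hu ε hε).imp fun n₀ hn₀ n hn => ?_⟩
  exact ControlledWith.of_tendsto (u := fun m => u n - u m)
    (eventually_atTop.2 ⟨n₀, fun m hm => hn₀ n hn m hm⟩)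
    (fun t => tendsto_const_nhds.sub (hpath t)) (fun t => tendsto_const_nhds.sub (hderiv t))

namespace IsControlledNorm

lemma nonneg (h : IsControlledNorm a b α W N) {Y : PathPair V X} (hY : Y ∈ controlled α W) :
    0 ≤ N Y :=
  nonneg_of_mul_nonneg_right (h.bound Y hY).nonneg h.pos

/-- The restriction of `N` to the space of controlled paths. -/
def addGroupNorm (h : IsControlledNorm a b α W N) :
    AddGroupNorm (controlledSubmodule (X := X) α W) where
  toFun Y := N Y
  map_zero' := by
    refine le_antisymm ?_ (h.nonneg (controlledSubmodule α W).zero_mem)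
    simpa using h.smul_le 0 0 (controlledSubmodule α W).zero_mem
  add_le' Y Z := h.add_le _ Y.2 _ Z.2
  neg' Y := by
    refine le_antisymm ?_ ?_
    · simpa using h.smul_le (-1) Y Y.2
    · simpa using h.smul_le (-1) (-Y) (-Y).2
  eq_zero_of_map_eq_zero' Y hY := by
    have hbound := h.bound _ Y.2
    rw [hY, mul_zero] at hbound
    exact Subtype.ext (Prod.ext (funext fun t => norm_le_zero_iff.1 (hbound.path t))
      (funext fun t => norm_le_zero_iff.1 (hbound.deriv t)))

lemma map_sub_rev (h : IsControlledNorm a b α W N) {Y Z : PathPair V X} (hY : Y ∈ controlled α W)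
    (hZ : Z ∈ controlled α W) : N (Y - Z) = N (Z - Y) :=
  _root_.map_sub_rev h.addGroupNorm ⟨Y, hY⟩ ⟨Z, hZ⟩

lemma abs_sub_le (h : IsControlledNorm a b α W N) {Y Z : PathPair V X} (hY : Y ∈ controlled α W)
    (hZ : Z ∈ controlled α W) : |N Y - N Z| ≤ N (Y - Z) :=
  abs_sub_map_le_sub h.addGroupNorm ⟨Y, hY⟩ ⟨Z, hZ⟩

lemma exists_limit [CompleteSpace X] (h : IsControlledNorm a b α W N) (hW : HolderWith w α W)
    (u : ℕ → PathPair V X) (hu : ∀ n, u n ∈ controlled α W)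
    (hcauchy : ∀ ε > 0, ∃ n₀, ∀ m ≥ n₀, ∀ n ≥ n₀, N (u m - u n) < ε) :
    ∃ Y ∈ controlled α W, ∀ ε > 0, ∃ n₀, ∀ n ≥ n₀, N (u n - Y) < ε := by
  obtain ⟨Y, hY⟩ := exists_limit_of_controlledWith (α := α) (W := W) (u := u) fun ε hε => by
    obtain ⟨n₀, hn₀⟩ := hcauchy (ε / a) (div_pos hε h.pos)
    refine ⟨n₀, fun m hm n hn => (h.bound _ (sub_mem_controlled (hu m) (hu n))).mono ?_⟩
    exact ((lt_div_iff₀' h.pos).1 (hn₀ m hm n hn)).le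
  refine ⟨Y, ?_, fun ε hε => ?_⟩
  · obtain ⟨n₀, hn₀⟩ := hY 1 one_pos
    simpa using sub_mem_controlled (hu n₀) ((hn₀ n₀ le_rfl).mem_controlled hW)
  · obtain ⟨n₀, hn₀⟩ := hY (ε / (|b| + 1)) (by positivity)
    refine ⟨n₀, fun n hn => (h.le _ _ (hn₀ n hn)).trans_lt ?_⟩
    rw [mul_div_left_comm]
    exact mul_lt_of_lt_one_right hε ((div_lt_one (by positivity)).2
      ((le_abs_self b).trans_lt (lt_add_one _)))

theorem existsUnique_fixedPoint [CompleteSpace X] (h : IsControlledNorm a b α W N)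
    (hW : HolderWith w α W) (Φ : PathPair V X → PathPair V X)
    (hΦ : ∀ Y ∈ controlled α W, Φ Y ∈ controlled α W) {K : ℝ} (hK0 : 0 ≤ K) (hK1 : K < 1)
    (hK : ∀ Y ∈ controlled α W, ∀ Z ∈ controlled α W, N (Φ Y - Φ Z) ≤ K * N (Y - Z)) :
    ∃! Y, Y ∈ controlled α W ∧ Φ Y = Y := by
  obtain ⟨Y, hY, hunique⟩ := existsUnique_fixedPoint_of_addGroupNorm h.addGroupNorm
    (fun u hu => by
      obtain ⟨Y, hY, hlim⟩ := h.exists_limit hW (fun n => u n) (fun n => (u n).2) hu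
      exact ⟨⟨Y, hY⟩, hlim⟩)
    (fun Y => ⟨Φ Y, hΦ _ Y.2⟩) hK0 hK1 (fun Y Z => hK _ Y.2 _ Z.2)
  exact ⟨Y, ⟨Y.2, congrArg Subtype.val hY⟩,
    fun Z hZ => congrArg Subtype.val (hunique ⟨Z, hZ.1⟩ (Subtype.ext hZ.2))⟩

end IsControlledNorm

end FixedPoint

/-! ### The cut-off -/

section Cutoff

variable {f : ℝ → ℝ}

lemma IsCutoff.eq_min_one (hf : IsCutoff f) (x : ℝ) : f x = f (min x 1) := by
  rcases le_total x 1 with hx | hx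
  · rw [min_eq_left hx]
  · rw [min_eq_right hx, hf.eq_zero x hx, hf.eq_zero 1 le_rfl]

lemma IsCutoff.exists_lipschitzOnWith (hf : IsCutoff f) :
    ∃ L : ℝ≥0, LipschitzOnWith L f (Set.Ici 0) := by
  have hIcc : ContDiffOn ℝ 1 f (Set.Icc 0 1) :=
    (hf.contDiffOn.of_le (by norm_num)).mono Set.Icc_subset_Ici_self
  obtain ⟨L, hL⟩ := (hIcc.locallyLipschitzOn
    (convex_Icc 0 1)).exists_lipschitzOnWith_of_compact isCompact_Icc
  refine ⟨L, LipschitzOnWith.of_dist_le_mul fun x hx y hy => ?_⟩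
  rw [hf.eq_min_one x, hf.eq_min_one y]
  refine (hL.dist_le_mul _ ⟨le_min hx zero_le_one, min_le_right _ _⟩ _
    ⟨le_min hy zero_le_one, min_le_right _ _⟩).trans ?_
  gcongr
  simpa [Real.dist_eq] using abs_min_sub_min_le_max x 1 y 1

variable {V X : Type*} [NormedAddCommGroup V] [InnerProductSpace ℝ V]
  [NormedAddCommGroup X] [NormedSpace ℝ X]
  {α : ℝ≥0} {W : I → V} {a b R : ℝ} {N : PathPair V X → ℝ} {Y Z : PathPair V X}

lemma cutoff_mem_controlled (N : PathPair V X → ℝ) (f : ℝ → ℝ) (R : ℝ)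
    (hY : Y ∈ controlled α W) : cutoff N f R Y ∈ controlled α W :=
  smul_mem_controlled _ hY

namespace IsControlledNorm

lemma map_cutoff_le (h : IsControlledNorm a b α W N) (hf : IsCutoff f) (hR : 0 < R)
    (hY : Y ∈ controlled α W) : N (cutoff N f R Y) ≤ R := by
  have hN := h.nonneg hY
  refine (h.smul_le (f (N Y / R)) Y hY).trans ?_
  rcases le_total (N Y) R with hle | hle
  · obtain ⟨hf0, hf1⟩ := hf.mem_Icc (N Y / R) (by positivity)
    rw [abs_of_nonneg hf0]
    exact (mul_le_of_le_one_left hN hf1).trans hle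
  · rw [hf.eq_zero _ ((one_le_div hR).2 hle)]
    simpa using hR.le

lemma controlledWith_cutoff (h : IsControlledNorm a b α W N) (hf : IsCutoff f) (hR : 0 < R)
    (hY : Y ∈ controlled α W) : ControlledWith (a * R) α W (cutoff N f R Y) :=
  (h.bound _ (cutoff_mem_controlled N f R hY)).mono
    (mul_le_mul_of_nonneg_left (h.map_cutoff_le hf hR hY) h.pos.le)

lemma map_cutoff_sub_le (h : IsControlledNorm a b α W N) (hf : IsCutoff f) {L : ℝ≥0}
    (hL : LipschitzOnWith L f (Set.Ici 0)) (hR : 0 < R)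
    (hY : Y ∈ controlled α W) (hZ : Z ∈ controlled α W) :
    N (cutoff N f R Y - cutoff N f R Z) ≤ (L + 1) * N (Y - Z) := by
  wlog hle : N Z ≤ N Y generalizing Y Z
  · rw [h.map_sub_rev hY hZ,
      h.map_sub_rev (cutoff_mem_controlled N f R hY) (cutoff_mem_controlled N f R hZ)]
    exact this hZ hY (le_of_not_ge hle)
  have hNY := h.nonneg hY
  have hNZ := h.nonneg hZ
  have hYZ := sub_mem_controlled hY hZ
  have hsplit : cutoff N f R Y - cutoff N f R Z =
      f (N Y / R) • (Y - Z) + (f (N Y / R) - f (N Z / R)) • Z := by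
    simp only [cutoff, smul_sub, sub_smul]
    abel
  have hfirst : N (f (N Y / R) • (Y - Z)) ≤ N (Y - Z) := by
    obtain ⟨hf0, hf1⟩ := hf.mem_Icc (N Y / R) (by positivity)
    refine (h.smul_le _ _ hYZ).trans ?_
    rw [abs_of_nonneg hf0]
    exact mul_le_of_le_one_left (h.nonneg hYZ) hf1
  have hsecond : N ((f (N Y / R) - f (N Z / R)) • Z) ≤ L * N (Y - Z) := by
    refine (h.smul_le _ _ hZ).trans ?_
    rcases le_total (N Z) R with hZR | hZR
    · have hLip := hL.dist_le_mul (N Y / R) (div_nonneg hNY hR.le) (N Z / R)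
        (div_nonneg hNZ hR.le)
      rw [Real.dist_eq, Real.dist_eq, ← sub_div, abs_div, abs_of_pos hR] at hLip
      calc |f (N Y / R) - f (N Z / R)| * N Z ≤ (L * (N (Y - Z) / R)) * R := by
            refine mul_le_mul (hLip.trans ?_) hZR hNZ
              (mul_nonneg L.2 (div_nonneg (h.nonneg hYZ) hR.le))
            gcongr
            exact h.abs_sub_le hY hZ
        _ = L * N (Y - Z) := by field_simp
    · rw [hf.eq_zero _ ((one_le_div hR).2 hZR), hf.eq_zero _ ((one_le_div hR).2 (hZR.trans hle))]
      simpa using mul_nonneg L.2 (h.nonneg hYZ)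
  rw [hsplit]
  linarith [h.add_le _ (smul_mem_controlled (f (N Y / R)) hYZ) _
    (smul_mem_controlled (f (N Y / R) - f (N Z / R)) hZ)]

end IsControlledNorm

end Cutoff

/-! ### The sewing lemma -/

section Sewing

open Filter Topology Finset

variable {E : Type*} [NormedAddCommGroup E] {K θ η : ℝ} {Ξ : I → I → E} {p : ℕ → I} {s t : I}

/-- The Riemann sum of the two-parameter function `Ξ` along the first `m` steps of `p`. -/
def riemannSum (Ξ : I → I → E) (p : ℕ → I) (m : ℕ) : E :=
  ∑ k ∈ range m, Ξ (p k) (p (k + 1))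

/-- `Ξ` is additive up to an error of order `θ`. -/
def AlmostAdditive (K θ : ℝ) (Ξ : I → I → E) : Prop :=
  ∀ s u t : I, s ≤ u → u ≤ t → ‖Ξ s t - Ξ s u - Ξ u t‖ ≤ K * ((t : ℝ) - s) ^ θ

/-- The constant in the sewing lemma of order `θ`. It solves `2 c / 2 ^ θ + 2 = c`, the fixed point
equation for the error of a Riemann sum that is cut in two near its midpoint. -/
def sewingConst (θ : ℝ) : ℝ := 2 / (1 - 2 / 2 ^ θ)

lemma one_sub_two_div_rpow_pos (hθ : 1 < θ) : 0 < 1 - 2 / (2 : ℝ) ^ θ := by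
  have : (2 : ℝ) < 2 ^ θ := Real.self_lt_rpow_of_one_lt one_lt_two hθ
  rwa [sub_pos, div_lt_one (by positivity)]

lemma sewingConst_pos (hθ : 1 < θ) : 0 < sewingConst θ :=
  div_pos two_pos (one_sub_two_div_rpow_pos hθ)

lemma sewingConst_eq (hθ : 1 < θ) : 2 * (sewingConst θ / 2 ^ θ) + 2 = sewingConst θ := by
  have hmul : sewingConst θ * (1 - 2 / 2 ^ θ) = 2 :=
    div_mul_cancel₀ _ (one_sub_two_div_rpow_pos hθ).ne'
  linear_combination -hmul

lemma exists_lt_le_le_succ {β : Type*} [LinearOrder β] {p : ℕ → β} {x : β} {m : ℕ} (hm : 0 < m)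
    (h0 : p 0 ≤ x) (hx : x ≤ p m) : ∃ j < m, p j ≤ x ∧ x ≤ p (j + 1) := by
  induction m, hm using Nat.le_induction with
  | base => exact ⟨0, one_pos, h0, hx⟩
  | succ m _ ih =>
    rcases le_total x (p m) with hxm | hxm
    · obtain ⟨j, hj, hjx⟩ := ih hxm
      exact ⟨j, hj.trans m.lt_succ_self, hjx⟩
    · exact ⟨m, m.lt_succ_self, hxm, hx⟩

lemma riemannSum_add_one_add (Ξ : I → I → E) (p : ℕ → I) (j l : ℕ) :
    riemannSum Ξ p (j + 1 + l) =
      riemannSum Ξ p j + Ξ (p j) (p (j + 1)) + riemannSum Ξ (fun k => p (j + 1 + k)) l := by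
  simp only [riemannSum, sum_range_add, sum_range_one, add_zero, add_assoc]

lemma riemannSum_two_mul (Ξ : I → I → E) (p : ℕ → I) (m : ℕ) :
    riemannSum Ξ p (2 * m) =
      ∑ k ∈ range m, (Ξ (p (2 * k)) (p (2 * k + 1)) + Ξ (p (2 * k + 1)) (p (2 * k + 2))) := by
  induction m with
  | zero => simp [riemannSum]
  | succ m ih =>
    rw [sum_range_succ, ← ih, mul_add_one, riemannSum, sum_range_succ, sum_range_succ, add_assoc]
    rfl

lemma sum_sub_rpow_le (hθ : 1 < θ) (hp : Monotone p) {m : ℕ}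
    (hη : ∀ k < m, (p (k + 1) : ℝ) - p k ≤ η) :
    ∑ k ∈ range m, ((p (k + 1) : ℝ) - p k) ^ θ ≤ η ^ (θ - 1) * ((p m : ℝ) - p 0) := by
  rw [← sum_range_sub (fun k => (p k : ℝ)) m, mul_sum]
  refine sum_le_sum fun k hk => ?_
  have hnonneg : 0 ≤ (p (k + 1) : ℝ) - p k := sub_nonneg.2 (hp k.le_succ)
  calc ((p (k + 1) : ℝ) - p k) ^ θ
      = ((p (k + 1) : ℝ) - p k) ^ (θ - 1) * ((p (k + 1) : ℝ) - p k) := by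
        rw [← Real.rpow_add_one' hnonneg (by linarith), sub_add_cancel]
    _ ≤ η ^ (θ - 1) * ((p (k + 1) : ℝ) - p k) := by
        have : 0 ≤ θ - 1 := by linarith
        gcongr
        exact hη k (mem_range.1 hk)

lemma sum_sub_rpow_le_mesh (hθ : 1 < θ) (hp : Monotone p) {m : ℕ}
    (hη : ∀ k < m, (p (k + 1) : ℝ) - p k ≤ η) (hη0 : 0 ≤ η) :
    ∑ k ∈ range m, ((p (k + 1) : ℝ) - p k) ^ θ ≤ η ^ (θ - 1) :=
  (sum_sub_rpow_le hθ hp hη).trans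
    (mul_le_of_le_one_right (by positivity) ((le_abs_self _).trans (abs_sub_le_one _ _)))

namespace AlmostAdditive

lemma nonneg (h : AlmostAdditive K θ Ξ) : 0 ≤ K := by
  simpa using (norm_nonneg _).trans (h 0 0 1 le_rfl zero_le_one)

lemma self_eq_zero (h : AlmostAdditive K θ Ξ) (hθ : 1 < θ) (x : I) : Ξ x x = 0 := by
  have hx := h x x x le_rfl le_rfl
  rw [sub_self, sub_self, Real.zero_rpow (by linarith), mul_zero, zero_sub, norm_neg] at hx
  exact norm_le_zero_iff.1 hx

/-- Cutting at the step that contains the midpoint leaves two sums over at most half the length. -/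
theorem norm_riemannSum_sub_le (h : AlmostAdditive K θ Ξ) (hθ : 1 < θ) (hp : Monotone p) (m : ℕ) :
    ‖riemannSum Ξ p m - Ξ (p 0) (p m)‖ ≤ sewingConst θ * K * ((p m : ℝ) - p 0) ^ θ := by
  induction m using Nat.strong_induction_on generalizing p with
  | _ m ih =>
  rcases m.eq_zero_or_pos with rfl | hm
  · simp [riemannSum, h.self_eq_zero hθ, Real.zero_rpow (by linarith : θ ≠ 0)]
  have h0m : (p 0 : ℝ) ≤ p m := hp m.zero_le
  obtain ⟨j, hjm, hjmid, hmidj⟩ := exists_lt_le_le_succ (p := fun k => (p k : ℝ))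
    (x := ((p 0 : ℝ) + p m) / 2) hm (by linarith) (by linarith)
  obtain ⟨l, rfl⟩ := Nat.exists_eq_add_of_le hjm
  have h0j : p 0 ≤ p j := hp j.zero_le
  have hj : p j ≤ p (j + 1) := hp j.le_succ
  have hjl : p (j + 1) ≤ p (j + 1 + l) := hp (Nat.le_add_right _ l)
  change ((p 0 : ℝ) + p (j + 1 + l)) / 2 ≤ p (j + 1 + 0) at hmidj
  set H : ℝ := (p (j + 1 + l) : ℝ) - p 0
  have hhalf : ∀ x : ℝ, 0 ≤ x → x ≤ H / 2 → x ^ θ ≤ H ^ θ / 2 ^ θ := fun x hx0 hx => by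
    rw [← Real.div_rpow (by linarith) two_pos.le]
    exact Real.rpow_le_rpow hx0 hx (by linarith)
  have hC := mul_nonneg (sewingConst_pos hθ).le h.nonneg
  have hleft := (ih j hjm hp).trans (mul_le_mul_of_nonneg_left
    (hhalf _ (sub_nonneg.2 h0j) (by linarith)) hC)
  have hright := (ih l (by omega) (p := fun k => p (j + 1 + k)) fun _ _ hkl => hp (by omega)).trans
    (mul_le_mul_of_nonneg_left (hhalf _ (sub_nonneg.2 hjl) (by linarith)) hC)
  have hcut := h (p 0) (p j) _ h0j (hj.trans hjl)
  have hlength : (p (j + 1 + l) : ℝ) - p j ≤ H := sub_le_sub_left (Subtype.coe_le_coe.2 h0j) _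
  have hmiddle := (h (p j) (p (j + 1)) _ hj hjl).trans (mul_le_mul_of_nonneg_left
    (Real.rpow_le_rpow (sub_nonneg.2 (hj.trans hjl)) hlength (by linarith)) h.nonneg)
  have hsplit : riemannSum Ξ p (j + 1 + l) - Ξ (p 0) (p (j + 1 + l)) =
      (riemannSum Ξ p j - Ξ (p 0) (p j)) +
      (riemannSum Ξ (fun k => p (j + 1 + k)) l - Ξ (p (j + 1)) (p (j + 1 + l))) -
      (Ξ (p 0) (p (j + 1 + l)) - Ξ (p 0) (p j) - Ξ (p j) (p (j + 1 + l))) -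
      (Ξ (p j) (p (j + 1 + l)) - Ξ (p j) (p (j + 1)) - Ξ (p (j + 1)) (p (j + 1 + l))) := by
    rw [riemannSum_add_one_add]
    abel
  rw [hsplit]
  refine (norm_sub_le_of_le (norm_sub_le_of_le (norm_add_le_of_le hleft hright) hcut)
    hmiddle).trans_eq ?_
  linear_combination (K * H ^ θ) * sewingConst_eq hθ

lemma norm_sub_inf_sub_sup_le (h : AlmostAdditive K θ Ξ) (hθ : 1 < θ) {x y : I} (hxy : x ≤ y)
    (s : I) :
    ‖Ξ x y - Ξ (x ⊓ s) (y ⊓ s) - Ξ (x ⊔ s) (y ⊔ s)‖ ≤ K * ((y : ℝ) - x) ^ θ := by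
  have hnonneg : 0 ≤ K * ((y : ℝ) - x) ^ θ :=
    mul_nonneg h.nonneg (Real.rpow_nonneg (sub_nonneg.2 hxy) _)
  rcases le_total s x with hsx | hxs
  · simpa [hsx, hsx.trans hxy, h.self_eq_zero hθ] using hnonneg
  rcases le_total y s with hys | hsy
  · simpa [hxs, hys, h.self_eq_zero hθ] using hnonneg
  · simpa [hxs, hsy] using h x s y hxs hsy

lemma norm_riemannSum_sub_inf_sub_sup_le (h : AlmostAdditive K θ Ξ) (hθ : 1 < θ)
    (hp : Monotone p) {m : ℕ} (hη : ∀ k < m, (p (k + 1) : ℝ) - p k ≤ η) (hη0 : 0 ≤ η) (s : I) :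
    ‖riemannSum Ξ p m - riemannSum Ξ (fun k => p k ⊓ s) m - riemannSum Ξ (fun k => p k ⊔ s) m‖ ≤
      K * η ^ (θ - 1) := by
  simp only [riemannSum, ← sum_sub_distrib]
  refine (norm_sum_le_of_le _ fun k _ => h.norm_sub_inf_sub_sup_le hθ (hp k.le_succ) s).trans ?_
  rw [← mul_sum]
  exact mul_le_mul_of_nonneg_left (sum_sub_rpow_le_mesh hθ hp hη hη0) h.nonneg

end AlmostAdditive

/-- The dyadic point `k / 2 ^ n` of the unit interval (`1` for `k ≥ 2 ^ n`). -/
def dyadic (n k : ℕ) : I := Set.projIcc 0 1 zero_le_one ((k : ℝ) / 2 ^ n)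

lemma dyadic_mono (n : ℕ) : Monotone (dyadic n) := fun k l h =>
  Set.monotone_projIcc _ (by gcongr)

lemma dyadic_zero (n : ℕ) : dyadic n 0 = 0 := by
  simp [dyadic]

lemma dyadic_two_pow (n : ℕ) : dyadic n (2 ^ n) = 1 := by
  simp [dyadic]

lemma dyadic_succ_two_mul (n k : ℕ) : dyadic (n + 1) (2 * k) = dyadic n k := by
  simp only [dyadic]
  congr 1
  push_cast
  field_simp
  ring

lemma dyadic_inf_mono (n : ℕ) (t : I) : Monotone fun k => dyadic n k ⊓ t := fun _ _ h =>
  inf_le_inf_right t (dyadic_mono n h)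

lemma dyadic_inf_sub_le (n k : ℕ) (t : I) :
    ((dyadic n (k + 1) ⊓ t : I) : ℝ) - (dyadic n k ⊓ t : I) ≤ 1 / 2 ^ n := by
  have hdyadic : |(dyadic n (k + 1) : ℝ) - dyadic n k| ≤ 1 / 2 ^ n := by
    refine (Set.abs_projIcc_sub_projIcc zero_le_one).trans_eq ?_
    rw [← sub_div, Nat.cast_add_one, add_sub_cancel_left, abs_of_nonneg (by positivity)]
  refine ((le_abs_self _).trans ?_).trans hdyadic
  simpa [(Subtype.mono_coe (· ∈ I)).map_inf] using
    abs_min_sub_min_le_max (dyadic n (k + 1) : ℝ) t (dyadic n k) t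

/-- The Riemann sum over `[0, t]` along the dyadic points of order `n`. -/
def dyadicSum (Ξ : I → I → E) (n : ℕ) (t : I) : E :=
  riemannSum Ξ (fun k => dyadic n k ⊓ t) (2 ^ n)

lemma one_div_two_pow_rpow (n : ℕ) (β : ℝ) :
    (1 / 2 ^ n : ℝ) ^ β = ((1 / 2) ^ β) ^ n := by
  rw [← one_div_pow, ← Real.rpow_natCast, ← Real.rpow_natCast, ← Real.rpow_mul (by norm_num),
    ← Real.rpow_mul (by norm_num), mul_comm]

namespace AlmostAdditive

lemma dist_dyadicSum_succ_le (h : AlmostAdditive K θ Ξ) (hθ : 1 < θ) (n : ℕ) (t : I) :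
    dist (dyadicSum Ξ n t) (dyadicSum Ξ (n + 1) t) ≤ K * ((1 / 2) ^ (θ - 1)) ^ n := by
  rw [dist_eq_norm, dyadicSum, dyadicSum, pow_succ', riemannSum_two_mul, riemannSum,
    ← sum_sub_distrib]
  have hterm : ∀ k ∈ range (2 ^ n),
      ‖Ξ (dyadic n k ⊓ t) (dyadic n (k + 1) ⊓ t) -
        (Ξ (dyadic (n + 1) (2 * k) ⊓ t) (dyadic (n + 1) (2 * k + 1) ⊓ t) +
          Ξ (dyadic (n + 1) (2 * k + 1) ⊓ t) (dyadic (n + 1) (2 * k + 2) ⊓ t))‖ ≤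
      K * (((dyadic n (k + 1) ⊓ t : I) : ℝ) - (dyadic n k ⊓ t : I)) ^ θ := fun k _ => by
    rw [← dyadic_succ_two_mul n k, ← dyadic_succ_two_mul n (k + 1), ← sub_sub]
    exact h _ _ _ (dyadic_inf_mono _ t (by omega)) (dyadic_inf_mono _ t (by omega))
  refine (norm_sum_le_of_le _ hterm).trans ?_
  rw [← mul_sum, ← one_div_two_pow_rpow]
  exact mul_le_mul_of_nonneg_left (sum_sub_rpow_le_mesh hθ (dyadic_inf_mono n t)
    (fun k _ => dyadic_inf_sub_le n k t) (by positivity)) h.nonneg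

lemma norm_dyadicSum_sub_sub_le (h : AlmostAdditive K θ Ξ) (hθ : 1 < θ) (n : ℕ) (hst : s ≤ t) :
    ‖dyadicSum Ξ n t - dyadicSum Ξ n s - Ξ s t‖ ≤
      K * ((1 / 2) ^ (θ - 1)) ^ n + sewingConst θ * K * ((t : ℝ) - s) ^ θ := by
  have hadd := h.norm_riemannSum_sub_inf_sub_sup_le hθ (dyadic_inf_mono n t) (m := 2 ^ n)
    (fun k _ => dyadic_inf_sub_le n k t) (by positivity) s
  have hmax := h.norm_riemannSum_sub_le hθ (p := fun k => dyadic n k ⊓ t ⊔ s)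
    (fun _ _ hkl => sup_le_sup_right (dyadic_inf_mono n t hkl) s) (2 ^ n)
  simp only [inf_assoc, inf_eq_right.2 hst, one_div_two_pow_rpow] at hadd
  simp only [dyadic_zero, dyadic_two_pow, inf_eq_left.2 (unitInterval.nonneg' (t := t)),
    inf_eq_right.2 (unitInterval.le_one' (t := t)), sup_eq_left.2 hst,
    sup_eq_right.2 (unitInterval.nonneg' (t := s))] at hmax
  have hsplit : dyadicSum Ξ n t - dyadicSum Ξ n s - Ξ s t =
      (dyadicSum Ξ n t - dyadicSum Ξ n s - riemannSum Ξ (fun k => dyadic n k ⊓ t ⊔ s) (2 ^ n)) +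
      (riemannSum Ξ (fun k => dyadic n k ⊓ t ⊔ s) (2 ^ n) - Ξ s t) := by
    abel
  rw [hsplit]
  exact norm_add_le_of_le hadd hmax

theorem exists_sewing [CompleteSpace E] (h : AlmostAdditive K θ Ξ) (hθ : 1 < θ) :
    ∃ J : I → E, J 0 = 0 ∧
      ∀ s t : I, s ≤ t → ‖J t - J s - Ξ s t‖ ≤ sewingConst θ * K * ((t : ℝ) - s) ^ θ := by
  have hr : (1 / 2 : ℝ) ^ (θ - 1) < 1 :=
    Real.rpow_lt_one (by norm_num) (by norm_num) (by linarith)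
  have hlim (t : I) : ∃ y, Tendsto (fun n => dyadicSum Ξ n t) atTop (𝓝 y) :=
    cauchySeq_tendsto_of_complete
      (cauchySeq_of_le_geometric _ _ hr fun n => h.dist_dyadicSum_succ_le hθ n t)
  choose J hJ using hlim
  refine ⟨J, ?_, fun s t hst => ?_⟩
  · refine tendsto_nhds_unique (hJ 0) (tendsto_const_nhds.congr fun n => ?_)
    simp [dyadicSum, riemannSum, h.self_eq_zero hθ]
  · have herror : Tendsto (fun n : ℕ => K * ((1 / 2 : ℝ) ^ (θ - 1)) ^ n +
        sewingConst θ * K * ((t : ℝ) - s) ^ θ) atTop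
        (𝓝 (K * 0 + sewingConst θ * K * ((t : ℝ) - s) ^ θ)) :=
      ((tendsto_pow_atTop_nhds_zero_of_lt_one (by positivity) hr).const_mul K).add_const _
    rw [mul_zero, zero_add] at herror
    exact le_of_tendsto_of_tendsto' (((hJ t).sub (hJ s)).sub_const _).norm herror
      fun n => h.norm_dyadicSum_sub_sub_le hθ n hst

end AlmostAdditive

lemma norm_riemannSum_sub_sub_le {J : I → E} {c : ℝ} (hθ : 1 < θ)
    (hJ : ∀ s t : I, s ≤ t → ‖J t - J s - Ξ s t‖ ≤ c * ((t : ℝ) - s) ^ θ)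
    (hp : Monotone p) {m : ℕ} (hη : ∀ k < m, (p (k + 1) : ℝ) - p k ≤ η) (hη0 : 0 ≤ η) :
    ‖riemannSum Ξ p m - (J (p m) - J (p 0))‖ ≤ c * η ^ (θ - 1) := by
  have hc : 0 ≤ c := by simpa using (norm_nonneg _).trans (hJ 0 1 zero_le_one)
  rw [riemannSum, ← sum_range_sub (fun k => J (p k)), ← sum_sub_distrib]
  have hterm : ∀ k ∈ range m, ‖Ξ (p k) (p (k + 1)) - (J (p (k + 1)) - J (p k))‖ ≤
      c * ((p (k + 1) : ℝ) - p k) ^ θ := fun k _ => by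
    rw [norm_sub_rev]
    exact hJ _ _ (hp k.le_succ)
  refine (norm_sum_le_of_le _ hterm).trans ?_
  rw [← mul_sum]
  exact mul_le_mul_of_nonneg_left (sum_sub_rpow_le_mesh hθ hp hη hη0) hc

namespace Partition

/-- The points of a partition as a sequence, constant after the last point. -/
def seq (P : Partition s t) (k : ℕ) : I := P.pt ⟨min k P.n, by omega⟩

lemma seq_mono (P : Partition s t) : Monotone P.seq := fun k l h =>
  P.strictMono.monotone (by simp only [Fin.mk_le_mk]; omega)

lemma seq_zero (P : Partition s t) : P.seq 0 = s := by
  refine Eq.trans ?_ P.pt_zero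
  simp [seq]

lemma seq_last (P : Partition s t) : P.seq P.n = t := by
  refine Eq.trans ?_ P.pt_last
  simp [seq, Fin.last]

lemma pt_castSucc (P : Partition s t) (i : Fin P.n) : P.pt i.castSucc = P.seq i := by
  rw [seq]
  congr 1
  ext
  simp [i.2.le]

lemma pt_succ (P : Partition s t) (i : Fin P.n) : P.pt i.succ = P.seq (i + 1) := by
  rw [seq]
  congr 1
  ext
  simp [Nat.succ_le_of_lt i.2]

lemma sum_eq_riemannSum (P : Partition s t) (Ξ : I → I → E) :
    ∑ i : Fin P.n, Ξ (P.pt i.castSucc) (P.pt i.succ) = riemannSum Ξ P.seq P.n := by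
  rw [riemannSum, ← Fin.sum_univ_eq_sum_range (fun k => Ξ (P.seq k) (P.seq (k + 1)))]
  simp only [P.pt_castSucc, P.pt_succ]

lemma norm_sum_sub_sub_le (P : Partition s t) {J : I → E} {c : ℝ} (hθ : 1 < θ)
    (hJ : ∀ s t : I, s ≤ t → ‖J t - J s - Ξ s t‖ ≤ c * ((t : ℝ) - s) ^ θ)
    (hη : ∀ i : Fin P.n, (P.pt i.succ : ℝ) - P.pt i.castSucc ≤ η) (hη0 : 0 ≤ η) :
    ‖∑ i : Fin P.n, Ξ (P.pt i.castSucc) (P.pt i.succ) - (J t - J s)‖ ≤ c * η ^ (θ - 1) := by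
  have hseq := norm_riemannSum_sub_sub_le hθ hJ P.seq_mono (m := P.n) (η := η)
    (fun k hk => by simpa only [P.pt_castSucc, P.pt_succ] using hη ⟨k, hk⟩) hη0
  rwa [P.seq_zero, P.seq_last, ← P.sum_eq_riemannSum] at hseq

end Partition

/-- The partition of `[s, t]` into `m + 1` intervals of equal length. -/
def uniformPartition (hst : s < t) (m : ℕ) : Partition s t where
  n := m + 1
  pt i := ⟨s + (i : ℕ) / ((m : ℝ) + 1) * (t - s), by
    have hi : ((i : ℕ) : ℝ) / ((m : ℝ) + 1) ≤ 1 := by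
      rw [div_le_one (by positivity)]
      exact_mod_cast Nat.lt_succ_iff.1 i.2
    exact (convex_Icc (0 : ℝ) 1).add_smul_sub_mem s.2 t.2 ⟨by positivity, hi⟩⟩
  strictMono i j hij := by
    have : (i : ℕ) < j := hij
    have : (0 : ℝ) < (t : ℝ) - s := sub_pos.2 hst
    simp only [Subtype.mk_lt_mk]
    gcongr
  pt_zero := by simp
  pt_last := by
    ext
    simp only [Fin.val_last]
    push_cast
    field_simp
    ring

lemma exists_partition (hst : s ≤ t) {δ : ℝ} (hδ : 0 < δ) :
    ∃ P : Partition s t, ∀ i : Fin P.n, (P.pt i.succ : ℝ) - P.pt i.castSucc < δ := by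
  rcases hst.eq_or_lt with rfl | hlt
  · exact ⟨⟨0, fun _ => s, fun i j h => by omega, rfl, rfl⟩, fun i => i.elim0⟩
  obtain ⟨m, hm⟩ := exists_nat_one_div_lt hδ
  refine ⟨uniformPartition hlt m, fun i => ?_⟩
  simp only [uniformPartition]
  calc (s : ℝ) + ((i + 1 : ℕ) : ℝ) / ((m : ℝ) + 1) * (t - s) -
        (s + (i : ℕ) / ((m : ℝ) + 1) * (t - s))
      = 1 / ((m : ℝ) + 1) * (t - s) := by push_cast; ring
    _ ≤ 1 / ((m : ℝ) + 1) :=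
      mul_le_of_le_one_right (by positivity) ((le_abs_self _).trans (abs_sub_le_one _ _))
    _ < δ := hm

end Sewing

/-! ### Rough integration of controlled paths -/

section RoughIntegral

variable {V X X' : Type*}
  [NormedAddCommGroup V] [InnerProductSpace ℝ V]
  [NormedAddCommGroup X] [NormedSpace ℝ X] [NormedAddCommGroup X'] [NormedSpace ℝ X']

lemma applyTensor_tmul (B : V →L[ℝ] V →L[ℝ] X) (v w : V) : applyTensor B (v ⊗ₜ[ℝ] w) = B v w := by
  simp [applyTensor]

lemma applyTensor_sub (B C : V →L[ℝ] V →L[ℝ] X) :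
    applyTensor (B - C) = applyTensor B - applyTensor C :=
  TensorProduct.ext' fun v w => by simp [applyTensor_tmul]

lemma applyTensor_compL (T : X →L[ℝ] X') (B : V →L[ℝ] V →L[ℝ] X) (τ : V ⊗[ℝ] V) :
    applyTensor ((ContinuousLinearMap.compL ℝ V X X' T).comp B) τ = T (applyTensor B τ) := by
  have hcomp : applyTensor ((ContinuousLinearMap.compL ℝ V X X' T).comp B) =
      (T : X →ₗ[ℝ] X').comp (applyTensor B) :=
    TensorProduct.ext' fun v w => by simp [applyTensor_tmul]
  rw [hcomp, LinearMap.comp_apply, ContinuousLinearMap.coe_coe]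

lemma norm_applyTensor_le [FiniteDimensional ℝ V] (B : V →L[ℝ] V →L[ℝ] X) (τ : V ⊗[ℝ] V) :
    ‖applyTensor B τ‖ ≤ (Module.finrank ℝ V) ^ 2 * ‖B‖ * ‖τ‖ := by
  let e := stdOrthonormalBasis ℝ V
  have hterm (p : Fin (Module.finrank ℝ V) × Fin (Module.finrank ℝ V)) :
      ‖applyTensor B (inner ℝ (e.tensorProduct e p) τ • e.tensorProduct e p)‖ ≤ ‖B‖ * ‖τ‖ := by
    have hinner : |inner ℝ (e.tensorProduct e p) τ| ≤ ‖τ‖ := by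
      simpa using abs_real_inner_le_norm (e.tensorProduct e p) τ
    have hB : ‖B (e p.1) (e p.2)‖ ≤ ‖B‖ := by
      simpa using B.le_opNorm₂ (e p.1) (e p.2)
    rw [map_smul, norm_smul, OrthonormalBasis.tensorProduct_apply', applyTensor_tmul, mul_comm,
      ← OrthonormalBasis.tensorProduct_apply']
    gcongr
    exact hinner
  calc ‖applyTensor B τ‖
      = ‖∑ p, applyTensor B (inner ℝ (e.tensorProduct e p) τ • e.tensorProduct e p)‖ := by
        rw [← map_sum, OrthonormalBasis.sum_repr']
    _ ≤ ∑ _p : Fin (Module.finrank ℝ V) × Fin (Module.finrank ℝ V), ‖B‖ * ‖τ‖ :=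
        norm_sum_le_of_le _ fun p _ => hterm p
    _ = (Module.finrank ℝ V) ^ 2 * ‖B‖ * ‖τ‖ := by
        simp [sq, mul_assoc]

variable {α w c : ℝ≥0} {M K D : ℝ} {W : RoughPath α V} {Y Z : PathPair V (V →L[ℝ] X)} {s t : I}
  {J J' : X}

variable (X) in
/-- Quantitative bounds on a rough path: `w` bounds the Hölder semi-norm of `W`, and `c` that of
`𝕎`, tested against bilinear maps with values in `X`. -/
structure RoughPath.BoundedBy (w c : ℝ≥0) (W : RoughPath α V) : Prop where
  path : HolderWith w α W.path
  area : ∀ (B : V →L[ℝ] V →L[ℝ] X) (s t : I),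
    ‖applyTensor B (W.area s t)‖ ≤ ‖B‖ * (c * |(t : ℝ) - s| ^ (2 * (α : ℝ)))

variable (X) in
theorem RoughPath.exists_boundedBy [FiniteDimensional ℝ V] (W : RoughPath α V) :
    ∃ w c : ℝ≥0, W.BoundedBy X w c := by
  obtain ⟨w, hw⟩ := W.path_holder
  obtain ⟨C, hC⟩ := W.area_holder
  refine ⟨w, (Module.finrank ℝ V) ^ 2 * C.toNNReal, hw, fun B s t => ?_⟩
  calc ‖applyTensor B (W.area s t)‖
      ≤ (Module.finrank ℝ V) ^ 2 * ‖B‖ * (C.toNNReal * |(t : ℝ) - s| ^ (2 * (α : ℝ))) := by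
        refine (norm_applyTensor_le B _).trans ?_
        gcongr
        exact (hC s t).trans (by gcongr; exact Real.le_coe_toNNReal C)
    _ = ‖B‖ * (((Module.finrank ℝ V) ^ 2 * C.toNNReal : ℝ≥0) *
          |(t : ℝ) - s| ^ (2 * (α : ℝ))) := by
        push_cast
        ring

/-- The summand `Z_s W_{s,t} + Z'_s 𝕎_{s,t}` of the compensated Riemann sums. -/
def germ (W : RoughPath α V) (Z : PathPair V (V →L[ℝ] X)) (s t : I) : X :=
  Z.1 s (W.path t - W.path s) + applyTensor (Z.2 s) (W.area s t)

lemma germ_sub_sub (W : RoughPath α V) (Z : PathPair V (V →L[ℝ] X)) (s u t : I) :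
    germ W Z s t - germ W Z s u - germ W Z u t =
      -(remainder W.path Z s u (W.path t - W.path u)) -
        applyTensor (Z.2 u - Z.2 s) (W.area u t) := by
  have hchen : W.area s t = W.area s u + W.area u t +
      (W.path u - W.path s) ⊗ₜ[ℝ] (W.path t - W.path u) := by
    rw [← W.chen s u t]
    abel
  simp only [germ, hchen, remainder, map_add, applyTensor_tmul, applyTensor_sub, map_sub,
    sub_apply, LinearMap.sub_apply]
  abel

lemma RoughPath.BoundedBy.almostAdditive_germ (hW : W.BoundedBy X w c)
    (hZ : ControlledWith M α W.path Z) :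
    AlmostAdditive ((w + c) * M) (3 * α) (germ W Z) := by
  intro s u t hsu hut
  have hM := hZ.nonneg
  have hst : 0 ≤ (t : ℝ) - s := sub_nonneg.2 (hsu.trans hut)
  have hleft : |(u : ℝ) - s| ≤ t - s := by
    rw [abs_of_nonneg (sub_nonneg.2 (Subtype.coe_le_coe.2 hsu))]
    exact sub_le_sub_right (Subtype.coe_le_coe.2 hut) _
  have hright : |(t : ℝ) - u| ≤ t - s := by
    rw [abs_of_nonneg (sub_nonneg.2 (Subtype.coe_le_coe.2 hut))]
    exact sub_le_sub_left (Subtype.coe_le_coe.2 hsu) _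
  have hrem : ‖remainder W.path Z s u (W.path t - W.path u)‖ ≤
      (M * ((t : ℝ) - s) ^ (2 * (α : ℝ))) * (w * ((t : ℝ) - s) ^ (α : ℝ)) :=
    ContinuousLinearMap.le_of_opNorm_le_of_le _ ((hZ.remainder s u).trans (by gcongr))
      ((holderWith_iff.1 hW.path u t).trans (by gcongr))
  have harea : ‖applyTensor (Z.2 u - Z.2 s) (W.area u t)‖ ≤
      (M * ((t : ℝ) - s) ^ (α : ℝ)) * (c * ((t : ℝ) - s) ^ (2 * (α : ℝ))) := by
    refine (hW.area _ u t).trans ?_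
    gcongr
    exact (hZ.deriv_sub s u).trans (by gcongr)
  have hpow : ((t : ℝ) - s) ^ (3 * (α : ℝ)) =
      ((t : ℝ) - s) ^ (2 * (α : ℝ)) * ((t : ℝ) - s) ^ (α : ℝ) := by
    rw [← Real.rpow_add_of_nonneg hst (by positivity) α.coe_nonneg]
    ring_nf
  rw [germ_sub_sub, hpow]
  refine (norm_sub_le_of_le ((norm_neg _).trans_le hrem) harea).trans_eq ?_
  ring

lemma remainder_eq_sub_apply_sub_remainder (W : I → V) (Y : PathPair V X) (s t : I) :
    remainder W Y s t = (Y.2 t - Y.2 s) (W t - W s) - remainder W Y t s := by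
  simp only [remainder, sub_apply, map_sub]
  abel

lemma norm_remainder_le_of_le {W : I → V} {Y : PathPair V X} (hW : HolderWith w α W)
    (hD : 0 ≤ D) (hY : ∀ s t : I, ‖Y.2 t - Y.2 s‖ ≤ D * |(t : ℝ) - s| ^ (α : ℝ))
    (hrem : ∀ s t : I, s ≤ t → ‖remainder W Y s t‖ ≤ K * |(t : ℝ) - s| ^ (2 * (α : ℝ)))
    (s t : I) : ‖remainder W Y s t‖ ≤ (K + D * w) * |(t : ℝ) - s| ^ (2 * (α : ℝ)) := by
  rcases le_total s t with hst | hts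
  · refine (hrem s t hst).trans ?_
    gcongr
    exact le_add_of_nonneg_right (by positivity)
  · have hcross : ‖(Y.2 t - Y.2 s) (W t - W s)‖ ≤
        (D * |(t : ℝ) - s| ^ (α : ℝ)) * (w * |(t : ℝ) - s| ^ (α : ℝ)) :=
      ContinuousLinearMap.le_of_opNorm_le_of_le _ (hY s t) (holderWith_iff.1 hW s t)
    have hpow : |(t : ℝ) - s| ^ (2 * (α : ℝ)) =
        |(t : ℝ) - s| ^ (α : ℝ) * |(t : ℝ) - s| ^ (α : ℝ) := by
      rw [← Real.rpow_add_of_nonneg (abs_nonneg _) α.coe_nonneg α.coe_nonneg, two_mul]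
    have hreverse := hrem t s hts
    rw [abs_sub_comm] at hreverse
    rw [remainder_eq_sub_apply_sub_remainder]
    refine (norm_sub_le_of_le hcross hreverse).trans_eq ?_
    rw [hpow]
    ring

namespace IsRoughIntegral

lemma unique (hst : s ≤ t) (h : IsRoughIntegral W Z s t J) (h' : IsRoughIntegral W Z s t J') :
    J = J' := by
  refine eq_of_forall_dist_le fun ε hε => ?_
  obtain ⟨δ, hδ, hJ⟩ := h (ε / 2) (half_pos hε)
  obtain ⟨δ', hδ', hJ'⟩ := h' (ε / 2) (half_pos hε)
  obtain ⟨P, hP⟩ := exists_partition hst (lt_min hδ hδ')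
  have hPJ := hJ P fun i => (hP i).trans_le (min_le_left _ _)
  have hPJ' := hJ' P fun i => (hP i).trans_le (min_le_right _ _)
  rw [← dist_eq_norm] at hPJ hPJ'
  linarith [dist_triangle_left J J' (compensatedSum W Z P)]

lemma roughIntegral_eq (h : IsRoughIntegral W Z s t J) (hst : s ≤ t) :
    roughIntegral W Z s t = J := by
  have hex : ∃ J, IsRoughIntegral W Z s t J := ⟨J, h⟩
  rw [roughIntegral, dif_pos hex]
  exact hex.choose_spec.unique hst h

lemma sub (h : IsRoughIntegral W Y s t J) (h' : IsRoughIntegral W Z s t J') :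
    IsRoughIntegral W (Y - Z) s t (J - J') := by
  intro ε hε
  obtain ⟨δ, hδ, hJ⟩ := h (ε / 2) (half_pos hε)
  obtain ⟨δ', hδ', hJ'⟩ := h' (ε / 2) (half_pos hε)
  refine ⟨min δ δ', lt_min hδ hδ', fun P hP => ?_⟩
  have hPJ := hJ P fun i => (hP i).trans_le (min_le_left _ _)
  have hPJ' := hJ' P fun i => (hP i).trans_le (min_le_right _ _)
  have hsub : compensatedSum W (Y - Z) P = compensatedSum W Y P - compensatedSum W Z P := by
    simp only [compensatedSum, ← Finset.sum_sub_distrib]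
    refine Finset.sum_congr rfl fun i _ => ?_
    simp only [Prod.fst_sub, Prod.snd_sub, Pi.sub_apply, applyTensor_sub, sub_apply,
      LinearMap.sub_apply]
    abel
  rw [hsub, sub_sub_sub_comm]
  exact (norm_sub_le _ _).trans_lt (by linarith)

end IsRoughIntegral

/-- The product of a controlled path with a path of operators. -/
def mulPair (Φ : I → X →L[ℝ] X') (Y : PathPair V X) : PathPair V X' :=
  (fun t => Φ t (Y.1 t), fun t => (Φ t).comp (Y.2 t))

lemma IsRoughIntegral.map (h : IsRoughIntegral W Z s t J) (T : X →L[ℝ] X') :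
    IsRoughIntegral W (mulPair (fun _ => ContinuousLinearMap.compL ℝ V X X' T) Z) s t (T J) := by
  intro ε hε
  obtain ⟨δ, hδ, hJ⟩ := h (ε / (‖T‖ + 1)) (by positivity)
  refine ⟨δ, hδ, fun P hP => ?_⟩
  have hmap : compensatedSum W (mulPair (fun _ => ContinuousLinearMap.compL ℝ V X X' T) Z) P =
      T (compensatedSum W Z P) := by
    simp only [compensatedSum, mulPair, map_sum, map_add, applyTensor_compL,
      ContinuousLinearMap.compL_apply, ContinuousLinearMap.comp_apply]
  have hPJ := hJ P hP
  rw [lt_div_iff₀ (by positivity)] at hPJ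
  rw [hmap, ← map_sub]
  exact (T.le_opNorm _).trans_lt (by linarith [norm_nonneg (compensatedSum W Z P - J)])

lemma isRoughIntegral_of_norm_sub_sub_germ_le {J : I → X} (hα : (1 : ℝ) < 3 * α)
    (hJ : ∀ s t : I, s ≤ t → ‖J t - J s - germ W Z s t‖ ≤ K * ((t : ℝ) - s) ^ (3 * (α : ℝ)))
    (s t : I) : IsRoughIntegral W Z s t (J t - J s) := by
  have hK : 0 ≤ K := by simpa using (norm_nonneg _).trans (hJ 0 1 zero_le_one)
  intro ε hε
  have hpos : 0 < ε / (K + 1) := by positivity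
  refine ⟨(ε / (K + 1)) ^ (3 * (α : ℝ) - 1)⁻¹, by positivity, fun P hP => ?_⟩
  refine (P.norm_sum_sub_sub_le hα hJ (fun i => (hP i).le) (by positivity)).trans_lt ?_
  rw [Real.rpow_inv_rpow hpos.le (by linarith), mul_div_assoc', div_lt_iff₀ (by positivity)]
  linarith

/-- A bound for the map `Z ↦ (∫ Z d𝐖, Z)` on controlled paths, for a rough path bounded by `w` and
`c`. -/
def roughIntegralConst (α w c : ℝ≥0) : ℝ :=
  sewingConst (3 * α) * (w + c) + c + (1 + w) ^ 2

lemma roughIntegralConst_pos (hα : (1 : ℝ) < 3 * α) (w c : ℝ≥0) :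
    0 < roughIntegralConst α w c := by
  have := sewingConst_pos hα
  unfold roughIntegralConst
  positivity

lemma RoughPath.BoundedBy.norm_remainder_le_of_norm_sub_sub_germ_le {J : I → X}
    (hW : W.BoundedBy X w c) (hZ : ControlledWith M α W.path Z)
    (hJ : ∀ s t : I, s ≤ t → ‖J t - J s - germ W Z s t‖ ≤ K * ((t : ℝ) - s) ^ (3 * (α : ℝ)))
    (hst : s ≤ t) :
    ‖remainder W.path (J, Z.1) s t‖ ≤ (K + c * M) * |(t : ℝ) - s| ^ (2 * (α : ℝ)) := by
  have hK : 0 ≤ K := by simpa using (norm_nonneg _).trans (hJ 0 1 zero_le_one)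
  have hsewing : ‖J t - J s - germ W Z s t‖ ≤ K * |(t : ℝ) - s| ^ (2 * (α : ℝ)) := by
    have hJst := hJ s t hst
    rw [← abs_of_nonneg (sub_nonneg.2 (Subtype.coe_le_coe.2 hst))] at hJst
    exact hJst.trans (mul_le_mul_of_nonneg_left
      (abs_sub_rpow_le_rpow s t (by positivity) (by linarith [α.2])) hK)
  have harea : ‖applyTensor (Z.2 s) (W.area s t)‖ ≤
      M * (c * |(t : ℝ) - s| ^ (2 * (α : ℝ))) :=
    (hW.area _ s t).trans (by gcongr; exact hZ.deriv s)
  have hsplit : remainder W.path (J, Z.1) s t =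
      (J t - J s - germ W Z s t) + applyTensor (Z.2 s) (W.area s t) := by
    simp only [germ, remainder]
    abel
  rw [hsplit]
  exact (norm_add_le_of_le hsewing harea).trans_eq (by ring)

theorem RoughPath.BoundedBy.exists_roughIntegral [CompleteSpace X] (hα : (1 : ℝ) < 3 * α)
    (hW : W.BoundedBy X w c) (hZ : ControlledWith M α W.path Z) :
    ∃ J : I → X, J 0 = 0 ∧ (∀ s t : I, IsRoughIntegral W Z s t (J t - J s)) ∧
      ControlledWith (roughIntegralConst α w c * M) α W.path (J, Z.1) := by
  obtain ⟨J, hJ0, hJ⟩ := (hW.almostAdditive_germ hZ).exists_sewing hα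
  have hM := hZ.nonneg
  have hw : (0 : ℝ) ≤ w := w.2
  have hS := sewingConst_pos hα
  set K := sewingConst (3 * α) * ((w + c) * M) with hK
  have hconst : roughIntegralConst α w c * M = K + c * M + (1 + w) * M * w + (1 + w) * M := by
    rw [roughIntegralConst, hK]
    ring
  have hK0 : 0 ≤ K + c * M := by positivity
  have hwM : 0 ≤ w * M := by positivity
  have hD : 0 ≤ (1 + w) * M := by positivity
  have hDw : 0 ≤ (1 + w) * M * w := by positivity
  have hrem := fun s t hst =>
    hW.norm_remainder_le_of_norm_sub_sub_germ_le (s := s) (t := t) hZ hJ hst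
  refine ⟨J, hJ0, isRoughIntegral_of_norm_sub_sub_germ_le hα hJ, fun t => ?_, fun t => ?_,
    fun s t => ?_, fun s t => ?_⟩
  · have hlinear : ‖Z.1 0 (W.path t - W.path 0)‖ ≤ M * w :=
      ContinuousLinearMap.le_of_opNorm_le_of_le _ (hZ.path 0)
        ((holderWith_iff.1 hW.path 0 t).trans
          (mul_le_of_le_one_right hw (abs_sub_rpow_le_one 0 t α.2)))
    have hrem₀ := (hrem 0 t unitInterval.nonneg').trans
      (mul_le_of_le_one_right hK0 (abs_sub_rpow_le_one 0 t (by positivity)))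
    have hJt : J t = Z.1 0 (W.path t - W.path 0) + remainder W.path (J, Z.1) 0 t := by
      rw [← sub_zero (J t), ← hJ0]
      exact sub_eq_deriv_add_remainder W.path (J, Z.1) 0 t
    change ‖J t‖ ≤ _
    rw [hJt]
    exact (norm_add_le_of_le hlinear hrem₀).trans (by linarith)
  · exact (hZ.path t).trans (by linarith)
  · exact (hZ.path_sub hW.path s t).trans
      (mul_le_mul_of_nonneg_right (by linarith) (by positivity))
  · have hle : K + c * M + (1 + w) * M * w ≤ roughIntegralConst α w c * M := by linarith
    have hst := norm_remainder_le_of_le (Y := (J, Z.1)) hW.path hD (hZ.path_sub hW.path) hrem s t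
    exact hst.trans (mul_le_mul_of_nonneg_right hle (by positivity))

end RoughIntegral

/-! ### Convolutions with the group `S` -/

section LipschitzBound

variable {E : Type*} [NormedAddCommGroup E] {V X X' : Type*} [NormedAddCommGroup V]
  [InnerProductSpace ℝ V] [NormedAddCommGroup X] [NormedSpace ℝ X] [NormedAddCommGroup X']
  [NormedSpace ℝ X'] {α : ℝ≥0} {M S : ℝ} {W : I → V} {Y : PathPair V X}

/-- The path `Φ` is bounded by `S` and Lipschitz continuous with constant `S`. -/
structure LipschitzBound (S : ℝ) (Φ : I → E) : Prop where
  norm_le : ∀ t, ‖Φ t‖ ≤ S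
  norm_sub_le : ∀ s t : I, ‖Φ t - Φ s‖ ≤ S * |(t : ℝ) - s|

namespace LipschitzBound

lemma nonneg {Φ : I → E} (h : LipschitzBound S Φ) : 0 ≤ S := (norm_nonneg _).trans (h.norm_le 0)

lemma norm_sub_le_rpow {Φ : I → E} (h : LipschitzBound S Φ) {β : ℝ} (hβ0 : 0 ≤ β) (hβ1 : β ≤ 1)
    (s t : I) : ‖Φ t - Φ s‖ ≤ S * |(t : ℝ) - s| ^ β := by
  have hpow := abs_sub_rpow_le_rpow s t hβ0 hβ1
  rw [Real.rpow_one] at hpow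
  exact (h.norm_sub_le s t).trans (mul_le_mul_of_nonneg_left hpow h.nonneg)

lemma map {φ : I → X} (h : LipschitzBound S φ) {T : X →L[ℝ] X'} (hT : ‖T‖ ≤ 1) :
    LipschitzBound S (fun t => T (φ t)) where
  norm_le t := (T.le_of_opNorm_le hT _).trans ((one_mul _).trans_le (h.norm_le t))
  norm_sub_le s t := by
    rw [← map_sub]
    exact (T.le_of_opNorm_le hT _).trans ((one_mul _).trans_le (h.norm_sub_le s t))

lemma controlledWith {φ : I → X} (h : LipschitzBound S φ) (hα : (α : ℝ) ≤ 1 / 2) :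
    ControlledWith S α W (φ, 0) where
  path := h.norm_le
  deriv t := by simpa using h.nonneg
  deriv_sub s t := by
    simpa using mul_nonneg h.nonneg (Real.rpow_nonneg (abs_nonneg _) _)
  remainder s t := by
    simpa [remainder] using h.norm_sub_le_rpow (by positivity) (by linarith) s t

end LipschitzBound

lemma mulPair_deriv_sub (Φ : I → X →L[ℝ] X') (Y : PathPair V X) (s t : I) :
    (mulPair Φ Y).2 t - (mulPair Φ Y).2 s =
      (Φ t - Φ s).comp (Y.2 t) + (Φ s).comp (Y.2 t - Y.2 s) := by
  simp [mulPair]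

lemma remainder_mulPair (W : I → V) (Φ : I → X →L[ℝ] X') (Y : PathPair V X) (s t : I) :
    remainder W (mulPair Φ Y) s t = (Φ t - Φ s) (Y.1 t) + Φ s (remainder W Y s t) := by
  simp only [mulPair, remainder, sub_apply, map_sub, ContinuousLinearMap.comp_apply]
  abel

lemma norm_comp_le_of_le {T : X →L[ℝ] X'} {U : V →L[ℝ] X} {a b : ℝ} (hT : ‖T‖ ≤ a)
    (hU : ‖U‖ ≤ b) : ‖T.comp U‖ ≤ a * b :=
  (T.opNorm_comp_le U).trans (mul_le_mul hT hU (norm_nonneg _) ((norm_nonneg _).trans hT))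

theorem ControlledWith.mulPair (hY : ControlledWith M α W Y) (hα : (α : ℝ) ≤ 1 / 2)
    {Φ : I → X →L[ℝ] X'} (hΦ : LipschitzBound S Φ) :
    ControlledWith (2 * S * M) α W (mulPair Φ Y) := by
  have hSM := mul_nonneg hΦ.nonneg hY.nonneg
  have hΦα := hΦ.norm_sub_le_rpow α.coe_nonneg (hα.trans (by norm_num))
  have hΦ2α := hΦ.norm_sub_le_rpow (β := 2 * α) (by positivity) (by linarith)
  refine ⟨fun t => ?_, fun t => ?_, fun s t => ?_, fun s t => ?_⟩
  · exact ((Φ t).le_of_opNorm_le_of_le (hΦ.norm_le t) (hY.path t)).trans (by linarith)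
  · exact (norm_comp_le_of_le (hΦ.norm_le t) (hY.deriv t)).trans (by linarith)
  · rw [mulPair_deriv_sub]
    refine (norm_add_le_of_le (norm_comp_le_of_le (hΦα s t) (hY.deriv t))
      (norm_comp_le_of_le (hΦ.norm_le s) (hY.deriv_sub s t))).trans_eq ?_
    ring
  · rw [remainder_mulPair]
    refine (norm_add_le_of_le
      (ContinuousLinearMap.le_of_opNorm_le_of_le _
        (hΦ2α s t) (hY.path t))
      (ContinuousLinearMap.le_of_opNorm_le_of_le _ (hΦ.norm_le s)
        (hY.remainder s t))).trans_eq ?_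
    ring

end LipschitzBound

section Semigroup

variable {X : Type*} [NormedAddCommGroup X] [NormedSpace ℝ X]

lemma sg_zero (A : X →L[ℝ] X) : sg A 0 = ContinuousLinearMap.id ℝ X := by
  rw [sg, zero_smul, NormedSpace.exp_zero]
  rfl

/-- `S` bounds, in norm and in Lipschitz norm, the group `S(r)` on `[0,1]` and its time reversals
`S(t - r)`, uniformly in `t ∈ [0,1]`. -/
structure SemigroupBound (S : ℝ) (A : X →L[ℝ] X) : Prop where
  forward : LipschitzBound S (fun r : I => sg A r)
  backward : ∀ t : I, LipschitzBound S (fun r : I => sg A ((t : ℝ) - r))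

variable [CompleteSpace X]

lemma sg_add (A : X →L[ℝ] X) (s t : ℝ) : sg A (s + t) = (sg A s).comp (sg A t) := by
  let : NormedAlgebra ℚ (X →L[ℝ] X) := NormedAlgebra.restrictScalars ℚ ℝ (X →L[ℝ] X)
  rw [sg, add_smul, NormedSpace.exp_add_of_commute (((Commute.refl A).smul_left s).smul_right t)]
  rfl

lemma sg_comp_sg_zero_sub (A : X →L[ℝ] X) (t r : ℝ) :
    (sg A t).comp (sg A (0 - r)) = sg A (t - r) := by
  rw [← sg_add, zero_sub, sub_eq_add_neg]

lemma hasDerivAt_sg (A : X →L[ℝ] X) (t : ℝ) : HasDerivAt (sg A) (sg A t * A) t :=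
  hasDerivAt_exp_smul_const A t

lemma continuous_sg (A : X →L[ℝ] X) : Continuous (sg A) :=
  continuous_iff_continuousAt.2 fun t => (hasDerivAt_sg A t).continuousAt

theorem exists_semigroupBound (A : X →L[ℝ] X) : ∃ S : ℝ, SemigroupBound S A := by
  obtain ⟨S, hS⟩ := (isCompact_Icc (a := (-1 : ℝ)) (b := 1)).exists_bound_of_continuousOn
    (continuous_sg A).continuousOn
  have hS0 : 0 ≤ S := (norm_nonneg _).trans (hS 0 (by norm_num))
  have hSA : 0 ≤ S * ‖A‖ := by positivity
  have hbound (τ : I → ℝ) (hτ : ∀ r, τ r ∈ Set.Icc (-1 : ℝ) 1)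
      (hτ' : ∀ r s, |τ s - τ r| = |(s : ℝ) - r|) :
      LipschitzBound (S + S * ‖A‖) (fun r => sg A (τ r)) := by
    refine ⟨fun r => (hS _ (hτ r)).trans (by linarith), fun r s => ?_⟩
    have hderiv := (convex_Icc (-1 : ℝ) 1).norm_image_sub_le_of_norm_hasDerivWithin_le
      (fun z _ => (hasDerivAt_sg A z).hasDerivWithinAt)
      (fun z hz => (norm_mul_le _ _).trans (mul_le_mul_of_nonneg_right (hS z hz) (norm_nonneg A)))
      (hτ r) (hτ s)
    rw [Real.norm_eq_abs, hτ'] at hderiv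
    exact hderiv.trans (mul_le_mul_of_nonneg_right (by linarith) (abs_nonneg _))
  refine ⟨S + S * ‖A‖, hbound _ (fun r => ⟨by linarith [r.2.1], r.2.2⟩) fun _ _ => rfl,
    fun t => hbound _ (fun r => abs_le.1 (abs_sub_le_one r t)) fun r s => ?_⟩
  rw [sub_sub_sub_cancel_left, abs_sub_comm]

end Semigroup

section Convolution

variable {V X : Type*} [NormedAddCommGroup V] [InnerProductSpace ℝ V] [NormedAddCommGroup X]
  [NormedSpace ℝ X] {α w c : ℝ≥0} {M M' S m : ℝ} {W : RoughPath α V}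
  {A : X →L[ℝ] X} {Y Z : PathPair V (V →L[ℝ] X)} {φ ψ : I → X}

lemma SemigroupBound.controlledWith_shifted (hS : SemigroupBound S A) (hα : (α : ℝ) ≤ 1 / 2)
    {W : I → V} (hZ : ControlledWith M α W Z) (t : I) :
    ControlledWith (2 * S * M) α W (shifted A t Z) :=
  hZ.mulPair hα ((hS.backward t).map (ContinuousLinearMap.norm_compL_le ℝ V X X))

variable [CompleteSpace X]

lemma shifted_eq_mulPair_shifted_zero (A : X →L[ℝ] X) (t : I) (Z : PathPair V (V →L[ℝ] X)) :
    shifted A t Z =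
      mulPair (fun _ => ContinuousLinearMap.compL ℝ V X X (sg A t)) (shifted A 0 Z) := by
  refine Prod.ext (funext fun r => ?_) (funext fun r => ContinuousLinearMap.ext fun v => ?_)
  · change (sg A ((t : ℝ) - r)).comp (Z.1 r) = (sg A t).comp ((sg A (0 - r)).comp (Z.1 r))
    rw [← ContinuousLinearMap.comp_assoc, sg_comp_sg_zero_sub]
  · change (sg A ((t : ℝ) - r)).comp (Z.2 r v) = (sg A t).comp ((sg A (0 - r)).comp (Z.2 r v))
    rw [← ContinuousLinearMap.comp_assoc, sg_comp_sg_zero_sub]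

lemma mulPair_sg_shifted_zero (A : X →L[ℝ] X) (J : I → X) (Z : PathPair V (V →L[ℝ] X)) :
    mulPair (fun t : I => sg A t) (J, (shifted A 0 Z).1) = (fun t : I => sg A t (J t), Z.1) := by
  refine Prod.ext rfl (funext fun t => ?_)
  change (sg A t).comp ((sg A (0 - t)).comp (Z.1 t)) = Z.1 t
  rw [← ContinuousLinearMap.comp_assoc, sg_comp_sg_zero_sub, sub_self, sg_zero,
    ContinuousLinearMap.id_comp]

lemma continuous_driftIntegrand (A : X →L[ℝ] X) (hφ : Continuous φ) (t : I) :
    Continuous (driftIntegrand A id φ t) :=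
  ((continuous_sg A).comp (continuous_const.sub continuous_id)).clm_apply
    (hφ.comp continuous_projIcc)

lemma driftConv_sub (A : X →L[ℝ] X) (hφ : Continuous φ) (hψ : Continuous ψ) :
    driftConv A id (φ - ψ) = driftConv A id φ - driftConv A id ψ := by
  funext t
  rw [Pi.sub_apply, driftConv, driftConv, driftConv, ← intervalIntegral.integral_sub
    ((continuous_driftIntegrand A hφ t).intervalIntegrable _ _)
    ((continuous_driftIntegrand A hψ t).intervalIntegrable _ _)]
  simp [driftIntegrand]

lemma driftConv_eq_sg_apply_integral (A : X →L[ℝ] X) (hφ : Continuous φ) (t : I) :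
    driftConv A id φ t = sg A t (∫ r in (0 : ℝ)..t, driftIntegrand A id φ 0 r) := by
  rw [driftConv, ← ContinuousLinearMap.intervalIntegral_comp_comm _
    ((continuous_driftIntegrand A hφ 0).intervalIntegrable _ _)]
  refine intervalIntegral.integral_congr fun r _ => ?_
  simp only [driftIntegrand, Set.Icc.coe_zero, ← ContinuousLinearMap.comp_apply,
    sg_comp_sg_zero_sub]

lemma SemigroupBound.lipschitzBound_integral (hS : SemigroupBound S A) (hφ : Continuous φ)
    (hm : ∀ t, ‖φ t‖ ≤ m) :
    LipschitzBound (S * m) (fun t : I => ∫ r in (0 : ℝ)..t, driftIntegrand A id φ 0 r) := by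
  have hcont := continuous_driftIntegrand A hφ 0
  have hbound (s t : I) : ∀ r ∈ Set.uIoc (s : ℝ) t, ‖driftIntegrand A id φ 0 r‖ ≤ S * m :=
    fun r hr => (ContinuousLinearMap.le_of_opNorm_le_of_le _ ((hS.backward 0).norm_le
      ⟨r, (Set.uIcc_subset_Icc s.2 t.2) (Set.uIoc_subset_uIcc hr)⟩) (hm _))
  have hsub (s t : I) : ‖(∫ r in (0 : ℝ)..t, driftIntegrand A id φ 0 r) -
      ∫ r in (0 : ℝ)..s, driftIntegrand A id φ 0 r‖ ≤ S * m * |(t : ℝ) - s| := by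
    rw [intervalIntegral.integral_interval_sub_left (hcont.intervalIntegrable _ _)
      (hcont.intervalIntegrable _ _)]
    exact intervalIntegral.norm_integral_le_of_norm_le_const (hbound s t)
  refine ⟨fun t => ?_, hsub⟩
  have hSm : 0 ≤ S * m :=
    mul_nonneg hS.forward.nonneg ((norm_nonneg _).trans (hm 0))
  simpa using (hsub 0 t).trans (mul_le_of_le_one_right hSm (abs_sub_le_one 0 t))

theorem controlledWith_driftConv (hα' : (α : ℝ) ≤ 1 / 2) (hS : SemigroupBound S A)
    (W : I → V) (hφ : Continuous φ) (hm : ∀ t, ‖φ t‖ ≤ m) :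
    ControlledWith (2 * S * (S * m)) α W (driftConv A id φ, 0) := by
  convert ((hS.lipschitzBound_integral hφ hm).controlledWith (W := W) hα').mulPair hα'
    hS.forward using 1
  refine Prod.ext (funext fun t => driftConv_eq_sg_apply_integral A hφ t) (funext fun t => ?_)
  simp [mulPair]

/-- The mild integral `(∫_0^· S(·-r) φ_r dr + ∫_0^· S(·-r) Z_r d𝐖_r, Z)` of a drift `φ` and a
diffusion `Z`. -/
def convPair (W : RoughPath α V) (A : X →L[ℝ] X) (φ : I → X) (Z : PathPair V (V →L[ℝ] X)) :
    PathPair V X :=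
  (fun t => driftConv A id φ t + roughConv W A Z t, Z.1)

variable (hα : (1 : ℝ) < 3 * α) (hα' : (α : ℝ) ≤ 1 / 2) (hW : W.BoundedBy X w c)
  (hS : SemigroupBound S A)

include hα hα' hW hS

theorem isRoughIntegral_roughConv (hZ : ControlledWith M α W.path Z) (t : I) :
    IsRoughIntegral W (shifted A t Z) 0 t (roughConv W A Z t) := by
  obtain ⟨J, -, hJ, -⟩ := hW.exists_roughIntegral hα (hS.controlledWith_shifted hα' hZ t)
  rw [roughConv, (hJ 0 t).roughIntegral_eq unitInterval.nonneg']
  exact hJ 0 t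

theorem controlledWith_roughConv (hZ : ControlledWith M α W.path Z) :
    ControlledWith (2 * S * (roughIntegralConst α w c * (2 * S * M))) α W.path
      (roughConv W A Z, Z.1) := by
  obtain ⟨J, hJ0, hJ, hcontrolled⟩ :=
    hW.exists_roughIntegral hα (hS.controlledWith_shifted hα' hZ 0)
  have hconv : roughConv W A Z = fun t : I => sg A t (J t) := funext fun t => by
    have hint := (hJ 0 t).map (sg A t)
    rw [← shifted_eq_mulPair_shifted_zero, hJ0, sub_zero] at hint
    exact hint.roughIntegral_eq unitInterval.nonneg'
  rw [hconv, ← mulPair_sg_shifted_zero]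
  exact hcontrolled.mulPair hα' hS.forward

theorem roughConv_sub (hY : ControlledWith M α W.path Y) (hZ : ControlledWith M' α W.path Z) :
    roughConv W A (Y - Z) = roughConv W A Y - roughConv W A Z := by
  refine funext fun t => IsRoughIntegral.roughIntegral_eq ?_ unitInterval.nonneg'
  have hshifted : shifted A t (Y - Z) = shifted A t Y - shifted A t Z := by
    refine Prod.ext (funext fun r => ?_) (funext fun r => ?_) <;> simp [shifted]
  rw [hshifted]
  exact (isRoughIntegral_roughConv hα hα' hW hS hY t).sub
    (isRoughIntegral_roughConv hα hα' hW hS hZ t)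

theorem controlledWith_convPair (hφ : Continuous φ) (hm : ∀ t, ‖φ t‖ ≤ m)
    (hZ : ControlledWith M α W.path Z) :
    ControlledWith (2 * S ^ 2 * (m + 2 * roughIntegralConst α w c * M)) α W.path
      (convPair W A φ Z) := by
  have hadd := (controlledWith_driftConv hα' hS W.path hφ hm).add
    (controlledWith_roughConv hα hα' hW hS hZ)
  have hpair : convPair W A φ Z = (driftConv A id φ, 0) + (roughConv W A Z, Z.1) :=
    Prod.ext rfl (zero_add _).symm
  rw [hpair]
  exact hadd.mono (by linarith)

theorem convPair_sub (hφ : Continuous φ) (hψ : Continuous ψ) (hY : ControlledWith M α W.path Y)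
    (hZ : ControlledWith M' α W.path Z) :
    convPair W A φ Y - convPair W A ψ Z = convPair W A (φ - ψ) (Y - Z) := by
  refine Prod.ext (funext fun t => ?_) rfl
  simp only [convPair, Prod.fst_sub, Pi.sub_apply, roughConv_sub hα hα' hW hS hY hZ,
    driftConv_sub A hφ hψ]
  abel

end Convolution

/-! ### Composition with maps vanishing to third order at the origin -/

section CubicAtZero

variable {X E : Type*} [NormedAddCommGroup X] [NormedSpace ℝ X] [NormedAddCommGroup E]
  [NormedSpace ℝ E] {G : X → E} {c : ℝ≥0} {x y : X} {M : ℝ}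

/-- `G` is twice differentiable with `c`-Lipschitz second derivative, and vanishes together with
its first two derivatives at the origin; thus `D^k G` is of size `‖x‖^(3-k)` near `0`. -/
structure CubicAtZero (c : ℝ≥0) (G : X → E) : Prop where
  differentiable : Differentiable ℝ G
  differentiable_fderiv : Differentiable ℝ (fderiv ℝ G)
  lipschitzWith : LipschitzWith c (fderiv ℝ (fderiv ℝ G))
  zero : G 0 = 0
  fderiv_zero : fderiv ℝ G 0 = 0
  fderiv_fderiv_zero : fderiv ℝ (fderiv ℝ G) 0 = 0

set_option maxSynthPendingDepth 3 in
lemma BoundedDerivs.exists_cubicAtZero (hG : BoundedDerivs 3 G) (hG0 : G 0 = 0)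
    (hG1 : fderiv ℝ G 0 = 0) (hG2 : fderiv ℝ (fderiv ℝ G) 0 = 0) : ∃ c, CubicAtZero c G := by
  obtain ⟨c, hc⟩ := hG.2 3 (by norm_num) le_rfl
  have hd : ContDiff ℝ 3 G := mod_cast hG.1
  have hd' : ContDiff ℝ 2 (fderiv ℝ G) := hd.fderiv_right (by norm_num)
  have hd'' : ContDiff ℝ 1 (fderiv ℝ (fderiv ℝ G)) := hd'.fderiv_right (by norm_num)
  have hc' (x : X) : ‖fderiv ℝ (fderiv ℝ (fderiv ℝ G)) x‖ ≤ c := by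
    rw [← norm_iteratedFDeriv_one, norm_iteratedFDeriv_fderiv, norm_iteratedFDeriv_fderiv]
    exact hc x
  lift c to ℝ≥0 using (norm_nonneg _).trans (hc' 0)
  exact ⟨c, hd.differentiable (by norm_num), hd'.differentiable (by norm_num),
    lipschitzWith_of_nnnorm_fderiv_le (hd''.differentiable (by norm_num)) hc', hG0, hG1, hG2⟩

namespace CubicAtZero

lemma fderiv_fderiv_comm (h : CubicAtZero c G) (x u v : X) :
    fderiv ℝ (fderiv ℝ G) x u v = fderiv ℝ (fderiv ℝ G) x v u :=
  second_derivative_symmetric (fun y => (h.differentiable y).hasFDerivAt)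
    (h.differentiable_fderiv x).hasFDerivAt u v

lemma norm_fderiv_fderiv_sub_le (h : CubicAtZero c G) (x y : X) :
    ‖fderiv ℝ (fderiv ℝ G) x - fderiv ℝ (fderiv ℝ G) y‖ ≤ c * ‖x - y‖ :=
  h.lipschitzWith.norm_sub_le x y

lemma norm_fderiv_fderiv_le (h : CubicAtZero c G) (hx : ‖x‖ ≤ M) :
    ‖fderiv ℝ (fderiv ℝ G) x‖ ≤ c * M := by
  have hsub := h.norm_fderiv_fderiv_sub_le x 0
  rw [h.fderiv_fderiv_zero, sub_zero, sub_zero] at hsub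
  exact hsub.trans (mul_le_mul_of_nonneg_left hx c.2)

lemma norm_fderiv_sub_le (h : CubicAtZero c G) (hx : ‖x‖ ≤ M) (hy : ‖y‖ ≤ M) :
    ‖fderiv ℝ G x - fderiv ℝ G y‖ ≤ c * M * ‖x - y‖ :=
  (convex_closedBall (0 : X) M).norm_image_sub_le_of_norm_fderiv_le
    (fun z _ => h.differentiable_fderiv z)
    (fun _ hz => h.norm_fderiv_fderiv_le (mem_closedBall_zero_iff.1 hz))
    (mem_closedBall_zero_iff.2 hy) (mem_closedBall_zero_iff.2 hx)

lemma norm_fderiv_le (h : CubicAtZero c G) (hx : ‖x‖ ≤ M) : ‖fderiv ℝ G x‖ ≤ c * M * M := by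
  have hM : 0 ≤ M := (norm_nonneg _).trans hx
  have hsub := h.norm_fderiv_sub_le hx (y := 0) (by simpa using hM)
  rw [h.fderiv_zero, sub_zero, sub_zero] at hsub
  exact hsub.trans (mul_le_mul_of_nonneg_left hx (mul_nonneg c.2 hM))

lemma norm_fderiv_sub_sub_le (h : CubicAtZero c G) (x y : X) :
    ‖fderiv ℝ G x - fderiv ℝ G y - fderiv ℝ (fderiv ℝ G) y (x - y)‖ ≤
      c * ‖x - y‖ * ‖x - y‖ := by
  refine (convex_segment y x).norm_image_sub_le_of_norm_hasFDerivWithin_le'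
    (fun z _ => (h.differentiable_fderiv z).hasFDerivAt.hasFDerivWithinAt)
    (fun z hz => (h.norm_fderiv_fderiv_sub_le z y).trans (mul_le_mul_of_nonneg_left ?_ c.2))
    (left_mem_segment ℝ y x) (right_mem_segment ℝ y x)
  exact norm_sub_le_of_mem_segment hz

end CubicAtZero

end CubicAtZero

section Composition

variable {V X E : Type*} [NormedAddCommGroup V] [InnerProductSpace ℝ V] [NormedAddCommGroup X]
  [NormedSpace ℝ X] [NormedAddCommGroup E] [NormedSpace ℝ E] {α w c : ℝ≥0} {W : I → V}
  {G : X → E} {Y Z H : PathPair V X} {M m : ℝ}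

/-- The composition `(G(Y), DG(Y)Y')`, which is `compose` when `G` takes values in `L(V, X)`. -/
def composePair (G : X → E) (Y : PathPair V X) : PathPair V E :=
  (fun t => G (Y.1 t), fun t => (fderiv ℝ G (Y.1 t)).comp (Y.2 t))

/-- The derivative of `Y ↦ composePair G Y` at `Y` in the direction `H`. -/
def derivPair (G : X → E) (Y H : PathPair V X) : PathPair V E :=
  (fun t => fderiv ℝ G (Y.1 t) (H.1 t),
   fun t => (fderiv ℝ (fderiv ℝ G) (Y.1 t) (H.1 t)).comp (Y.2 t) +
     (fderiv ℝ G (Y.1 t)).comp (H.2 t))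

lemma derivPair_deriv_sub (G : X → E) (Y H : PathPair V X) (s t : I) :
    (derivPair G Y H).2 t - (derivPair G Y H).2 s =
      ((fderiv ℝ (fderiv ℝ G) (Y.1 t) - fderiv ℝ (fderiv ℝ G) (Y.1 s)) (H.1 t)).comp (Y.2 t) +
      (fderiv ℝ (fderiv ℝ G) (Y.1 s) (H.1 t - H.1 s)).comp (Y.2 t) +
      (fderiv ℝ (fderiv ℝ G) (Y.1 s) (H.1 s)).comp (Y.2 t - Y.2 s) +
      (fderiv ℝ G (Y.1 t) - fderiv ℝ G (Y.1 s)).comp (H.2 t) +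
      (fderiv ℝ G (Y.1 s)).comp (H.2 t - H.2 s) := by
  simp only [derivPair, sub_apply, map_sub, ContinuousLinearMap.sub_comp,
    ContinuousLinearMap.comp_sub]
  abel

lemma ControlledWith.sub_of_hasDerivAt {u u' : ℝ → PathPair V E}
    (hpath : ∀ θ t, HasDerivAt (fun θ => (u θ).1 t) ((u' θ).1 t) θ)
    (hderiv : ∀ θ t, HasDerivAt (fun θ => (u θ).2 t) ((u' θ).2 t) θ)
    (hM : ∀ θ ∈ Set.Ico (0 : ℝ) 1, ControlledWith M α W (u' θ)) :
    ControlledWith M α W (u 1 - u 0) where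
  path t := norm_image_sub_le_of_norm_deriv_le_segment_01'
    (fun θ _ => (hpath θ t).hasDerivWithinAt) fun θ hθ => (hM θ hθ).path t
  deriv t := norm_image_sub_le_of_norm_deriv_le_segment_01'
    (fun θ _ => (hderiv θ t).hasDerivWithinAt) fun θ hθ => (hM θ hθ).deriv t
  deriv_sub s t := by
    rw [Prod.snd_sub, Pi.sub_apply, Pi.sub_apply, sub_sub_sub_comm]
    exact norm_image_sub_le_of_norm_deriv_le_segment_01' (f := fun θ => (u θ).2 t - (u θ).2 s)
      (fun θ _ => ((hderiv θ t).sub (hderiv θ s)).hasDerivWithinAt)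
      fun θ hθ => (hM θ hθ).deriv_sub s t
  remainder s t := by
    have hrem (θ : ℝ) : HasDerivAt (fun θ => RoughCutoff.remainder W (u θ) s t)
        (RoughCutoff.remainder W (u' θ) s t) θ := by
      refine (((hpath θ t).sub (hpath θ s)).sub
        ((hderiv θ s).clm_apply (hasDerivAt_const θ (W t - W s)))).congr_deriv ?_
      simp [RoughCutoff.remainder]
    have hsub : RoughCutoff.remainder W (u 1 - u 0) s t =
        RoughCutoff.remainder W (u 1) s t - RoughCutoff.remainder W (u 0) s t :=
      eq_sub_of_add_eq (by rw [← remainder_add, sub_add_cancel])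
    rw [hsub]
    exact norm_image_sub_le_of_norm_deriv_le_segment_01'
      (fun θ _ => (hrem θ).hasDerivWithinAt) fun θ hθ => (hM θ hθ).remainder s t

namespace CubicAtZero

lemma remainder_derivPair (h : CubicAtZero c G) (W : I → V) (Y H : PathPair V X)
    (s t : I) :
    remainder W (derivPair G Y H) s t =
      (fderiv ℝ G (Y.1 t) - fderiv ℝ G (Y.1 s)) (H.1 t - H.1 s) +
      (fderiv ℝ G (Y.1 t) - fderiv ℝ G (Y.1 s) -
        fderiv ℝ (fderiv ℝ G) (Y.1 s) (Y.1 t - Y.1 s)) (H.1 s) +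
      fderiv ℝ (fderiv ℝ G) (Y.1 s) (remainder W Y s t) (H.1 s) +
      fderiv ℝ G (Y.1 s) (remainder W H s t) := by
  simp only [remainder, derivPair, sub_apply, add_apply, map_sub,
    ContinuousLinearMap.comp_apply, h.fderiv_fderiv_comm (Y.1 s) (H.1 s)]
  abel

lemma norm_derivPair_deriv_sub_le (h : CubicAtZero c G) (hW : HolderWith w α W)
    (hY : ControlledWith M α W Y) (hH : ControlledWith m α W H) (s t : I) :
    ‖(derivPair G Y H).2 t - (derivPair G Y H).2 s‖ ≤
      (3 * (1 + w) + 2) * (c * M ^ 2 * m) * |(t : ℝ) - s| ^ (α : ℝ) := by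
  have hcM : 0 ≤ c * M := mul_nonneg c.2 hY.nonneg
  have hsecond := norm_comp_le_of_le (ContinuousLinearMap.le_of_opNorm_le_of_le _
    ((h.norm_fderiv_fderiv_sub_le (Y.1 t) (Y.1 s)).trans
      (mul_le_mul_of_nonneg_left (hY.path_sub hW s t) c.2)) (hH.path t)) (hY.deriv t)
  have hdirection := norm_comp_le_of_le (ContinuousLinearMap.le_of_opNorm_le_of_le _
    (h.norm_fderiv_fderiv_le (hY.path s)) (hH.path_sub hW s t)) (hY.deriv t)
  have hderiv := norm_comp_le_of_le (ContinuousLinearMap.le_of_opNorm_le_of_le _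
    (h.norm_fderiv_fderiv_le (hY.path s)) (hH.path s)) (hY.deriv_sub s t)
  have hfirst := norm_comp_le_of_le ((h.norm_fderiv_sub_le (hY.path t) (hY.path s)).trans
    (mul_le_mul_of_nonneg_left (hY.path_sub hW s t) hcM)) (hH.deriv t)
  have hderiv' := norm_comp_le_of_le (h.norm_fderiv_le (hY.path s)) (hH.deriv_sub s t)
  rw [derivPair_deriv_sub]
  refine (norm_add_le_of_le (norm_add_le_of_le (norm_add_le_of_le
    (norm_add_le_of_le hsecond hdirection) hderiv) hfirst) hderiv').trans_eq ?_
  ring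

lemma norm_remainder_derivPair_le (h : CubicAtZero c G) (hW : HolderWith w α W)
    (hY : ControlledWith M α W Y) (hH : ControlledWith m α W H) (s t : I) :
    ‖remainder W (derivPair G Y H) s t‖ ≤
      (2 * (1 + w) ^ 2 + 2) * (c * M ^ 2 * m) * |(t : ℝ) - s| ^ (2 * (α : ℝ)) := by
  have hM := hY.nonneg
  have hpow : |(t : ℝ) - s| ^ (2 * (α : ℝ)) =
      |(t : ℝ) - s| ^ (α : ℝ) * |(t : ℝ) - s| ^ (α : ℝ) := by
    rw [← Real.rpow_add_of_nonneg (abs_nonneg _) α.coe_nonneg α.coe_nonneg, two_mul]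
  have hfirst := ContinuousLinearMap.le_of_opNorm_le_of_le _
    ((h.norm_fderiv_sub_le (hY.path t) (hY.path s)).trans
      (mul_le_mul_of_nonneg_left (hY.path_sub hW s t) (by positivity))) (hH.path_sub hW s t)
  have htaylor := ContinuousLinearMap.le_of_opNorm_le_of_le _
    ((h.norm_fderiv_sub_sub_le (Y.1 t) (Y.1 s)).trans
      (mul_le_mul (mul_le_mul_of_nonneg_left (hY.path_sub hW s t) c.2) (hY.path_sub hW s t)
        (norm_nonneg _) (by positivity))) (hH.path s)
  have hrem := ContinuousLinearMap.le_of_opNorm_le_of_le _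
    (ContinuousLinearMap.le_of_opNorm_le_of_le _
      (h.norm_fderiv_fderiv_le (hY.path s)) (hY.remainder s t)) (hH.path s)
  have hrem' := ContinuousLinearMap.le_of_opNorm_le_of_le _ (h.norm_fderiv_le (hY.path s))
    (hH.remainder s t)
  rw [h.remainder_derivPair]
  refine (norm_add_le_of_le (norm_add_le_of_le (norm_add_le_of_le hfirst htaylor) hrem)
    hrem').trans_eq ?_
  rw [hpow]
  ring

theorem controlledWith_derivPair (h : CubicAtZero c G) (hW : HolderWith w α W)
    (hY : ControlledWith M α W Y) (hH : ControlledWith m α W H) :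
    ControlledWith (5 * (1 + w) ^ 2 * (c * M ^ 2 * m)) α W (derivPair G Y H) := by
  have hcMm : 0 ≤ c * M ^ 2 * m := mul_nonneg (mul_nonneg c.2 (sq_nonneg M)) hH.nonneg
  have hw : (1 : ℝ) ≤ 1 + w := le_add_of_nonneg_right w.2
  have hw2 : (1 + w : ℝ) ≤ (1 + w) ^ 2 := le_self_pow₀ hw two_ne_zero
  refine ⟨fun t => ?_, fun t => ?_, fun s t => ?_, fun s t => ?_⟩
  · have hpath := ContinuousLinearMap.le_of_opNorm_le_of_le _ (h.norm_fderiv_le (hY.path t))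
      (hH.path t)
    refine hpath.trans ?_
    nlinarith
  · have hderiv := norm_add_le_of_le
      (norm_comp_le_of_le (ContinuousLinearMap.le_of_opNorm_le_of_le _
        (h.norm_fderiv_fderiv_le (hY.path t)) (hH.path t)) (hY.deriv t))
      (norm_comp_le_of_le (h.norm_fderiv_le (hY.path t)) (hH.deriv t))
    refine hderiv.trans ?_
    nlinarith
  · refine (h.norm_derivPair_deriv_sub_le hW hY hH s t).trans ?_
    gcongr
    linarith
  · refine (h.norm_remainder_derivPair_le hW hY hH s t).trans ?_
    gcongr
    linarith

theorem controlledWith_composePair_sub (h : CubicAtZero c G) (hW : HolderWith w α W)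
    (hY : ControlledWith M α W Y) (hZ : ControlledWith M α W Z)
    (hYZ : ControlledWith m α W (Y - Z)) :
    ControlledWith (5 * (1 + w) ^ 2 * (c * M ^ 2 * m)) α W
      (composePair G Y - composePair G Z) := by
  have hpath (θ : ℝ) (t : I) :
      HasDerivAt (fun θ : ℝ => (Z + θ • (Y - Z)).1 t) ((Y - Z).1 t) θ := by
    simpa using ((hasDerivAt_id θ).smul_const ((Y - Z).1 t)).const_add (Z.1 t)
  have hderiv (θ : ℝ) (t : I) :
      HasDerivAt (fun θ : ℝ => (Z + θ • (Y - Z)).2 t) ((Y - Z).2 t) θ := by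
    simpa using ((hasDerivAt_id θ).smul_const ((Y - Z).2 t)).const_add (Z.2 t)
  have hsegment : ∀ θ ∈ Set.Ico (0 : ℝ) 1, ControlledWith M α W (Z + θ • (Y - Z)) := by
    intro θ hθ
    have hconvex := (hZ.smul (1 - θ)).add (hY.smul θ)
    rw [abs_of_nonneg hθ.1, abs_of_nonneg (sub_nonneg.2 hθ.2.le), ← add_mul, sub_add_cancel,
      one_mul] at hconvex
    convert hconvex using 1
    module
  have hsub := ControlledWith.sub_of_hasDerivAt
    (u := fun θ => composePair G (Z + θ • (Y - Z)))
    (u' := fun θ => derivPair G (Z + θ • (Y - Z)) (Y - Z))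
    (fun θ t => (h.differentiable _).hasFDerivAt.comp_hasDerivAt θ (hpath θ t))
    (fun θ t => ((h.differentiable_fderiv _).hasFDerivAt.comp_hasDerivAt θ
      (hpath θ t)).clm_comp (hderiv θ t))
    (fun θ hθ => h.controlledWith_derivPair hW (hsegment θ hθ) hYZ)
  simpa only [one_smul, add_sub_cancel, zero_smul, add_zero] using hsub

theorem controlledWith_composePair (h : CubicAtZero c G) (hW : HolderWith w α W)
    (hY : ControlledWith M α W Y) :
    ControlledWith (5 * (1 + w) ^ 2 * (c * M ^ 2 * M)) α W (composePair G Y) := by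
  have hzero : ControlledWith M α W (0 : PathPair V X) := by
    rw [← zero_smul ℝ Y]
    exact (hY.smul 0).mono (by simpa using hY.nonneg)
  have hcompose : composePair G (0 : PathPair V X) = 0 :=
    Prod.ext (funext fun _ => h.zero) (funext fun _ => ContinuousLinearMap.comp_zero _)
  simpa only [hcompose, sub_zero] using
    h.controlledWith_composePair_sub hW hY hzero (by simpa only [sub_zero] using hY)

end CubicAtZero

end Composition

/-! ### The truncated mild solution map -/

section MildMap

variable {V X : Type*} [NormedAddCommGroup V] [InnerProductSpace ℝ V]
  [NormedAddCommGroup X] [NormedSpace ℝ X] {α w c c' : ℝ≥0} {S M m a b : ℝ} {W : RoughPath α V}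
  {A : X →L[ℝ] X} {F : X → X} {G : X → V →L[ℝ] X} {N : PathPair V X → ℝ} {f : ℝ → ℝ} {R : ℝ}
  {Y Z : PathPair V X}

lemma continuous_of_mem_controlled {W : I → V} (hα : 0 < α) (hY : Y ∈ controlled α W) :
    Continuous Y.1 := by
  obtain ⟨C, hC⟩ := hY.1
  exact hC.continuous hα

lemma mildMap_eq_convPair (W : RoughPath α V) (A : X →L[ℝ] X) (F : X → X) (G : X → V →L[ℝ] X)
    (N : PathPair V X → ℝ) (f : ℝ → ℝ) (R : ℝ) (Y : PathPair V X) :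
    mildMap W A F G N f R Y =
      convPair W A (F ∘ (cutoff N f R Y).1) (composePair G (cutoff N f R Y)) :=
  rfl

lemma exists_controlledWith_compose_cutoff (h : IsControlledNorm a b α W.path N)
    (hG : CubicAtZero c' G) (hW : HolderWith w α W.path) (f : ℝ → ℝ) (R : ℝ)
    (hY : Y ∈ controlled α W.path) :
    ∃ M, ControlledWith M α W.path (compose G (cutoff N f R Y)) :=
  ⟨_, hG.controlledWith_composePair hW (h.bound _ (cutoff_mem_controlled N f R hY))⟩

lemma SemigroupBound.controlledWith_initialPair (hS : SemigroupBound S A) (hα' : (α : ℝ) ≤ 1 / 2)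
    (W : I → V) (ξ : X) : ControlledWith (S * ‖ξ‖) α W (initialPair A ξ) := by
  have hbound : LipschitzBound (S * ‖ξ‖) (fun t : I => sg A t ξ) := by
    refine ⟨fun t => ContinuousLinearMap.le_of_opNorm_le _ (hS.forward.norm_le t) ξ,
      fun s t => ?_⟩
    rw [mul_right_comm]
    exact ContinuousLinearMap.le_of_opNorm_le _ (hS.forward.norm_sub_le s t) ξ
  exact hbound.controlledWith hα'

variable [CompleteSpace X]

theorem mildMap_mem_controlled (h : IsControlledNorm a b α W.path N) (hα : (1 : ℝ) < 3 * α)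
    (hα' : (α : ℝ) ≤ 1 / 2) (hW : W.BoundedBy X w c) (A : X →L[ℝ] X) (hF : Continuous F)
    (hG : CubicAtZero c' G) (f : ℝ → ℝ) (R : ℝ) (hY : Y ∈ controlled α W.path) :
    mildMap W A F G N f R Y ∈ controlled α W.path := by
  have hα0 : 0 < α := by exact_mod_cast (by linarith : (0 : ℝ) < α)
  obtain ⟨S, hS⟩ := exists_semigroupBound A
  obtain ⟨M, hM⟩ := exists_controlledWith_compose_cutoff h hG hW.path f R hY
  have hφ := hF.comp (continuous_of_mem_controlled hα0 (cutoff_mem_controlled N f R hY))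
  obtain ⟨m, hm⟩ := isCompact_univ.exists_bound_of_continuousOn hφ.continuousOn
  exact (controlledWith_convPair hα hα' hW hS hφ (fun t => hm t trivial) hM).mem_controlled hW.path

theorem controlledWith_convPair_comp_sub (hα : (1 : ℝ) < 3 * α) (hα' : (α : ℝ) ≤ 1 / 2)
    (hW : W.BoundedBy X w c) (hS : SemigroupBound S A) (hF : Continuous F) {ε : ℝ≥0}
    (hε : LipschitzOnWith ε F (Metric.closedBall 0 M)) (hG : CubicAtZero c' G)
    (hY : ControlledWith M α W.path Y) (hZ : ControlledWith M α W.path Z)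
    (hYZ : ControlledWith m α W.path (Y - Z)) :
    ControlledWith (2 * S ^ 2 * (ε + 10 * roughIntegralConst α w c * (1 + w) ^ 2 * c' * M ^ 2) * m)
      α W.path
      (convPair W A (F ∘ Y.1) (composePair G Y) - convPair W A (F ∘ Z.1) (composePair G Z)) := by
  have hα0 : 0 < α := by exact_mod_cast (by linarith : (0 : ℝ) < α)
  have hφ := hF.comp (continuous_of_mem_controlled hα0 (hY.mem_controlled hW.path))
  have hψ := hF.comp (continuous_of_mem_controlled hα0 (hZ.mem_controlled hW.path))
  have hdrift (t : I) : ‖(F ∘ Y.1 - F ∘ Z.1) t‖ ≤ ε * m :=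
    (hε.norm_sub_le (mem_closedBall_zero_iff.2 (hY.path t))
      (mem_closedBall_zero_iff.2 (hZ.path t))).trans
      (mul_le_mul_of_nonneg_left (hYZ.path t) ε.coe_nonneg)
  rw [convPair_sub hα hα' hW hS hφ hψ (hG.controlledWith_composePair hW.path hY)
    (hG.controlledWith_composePair hW.path hZ)]
  exact (controlledWith_convPair hα hα' hW hS (hφ.sub hψ) hdrift
    (hG.controlledWith_composePair_sub hW.path hY hZ hYZ)).mono (by linarith)

theorem exists_mildMap_sub_le (h : IsControlledNorm a b α W.path N) (hα : (1 : ℝ) < 3 * α)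
    (hα' : (α : ℝ) ≤ 1 / 2) (hW : W.BoundedBy X w c) (A : X →L[ℝ] X) (hF : Continuous F)
    (hG : CubicAtZero c' G) (hf : IsCutoff f) :
    ∃ C : ℝ, 0 ≤ C ∧ ∀ (R : ℝ) (ε : ℝ≥0), 0 < R →
      LipschitzOnWith ε F (Metric.closedBall 0 (a * R)) →
      ∀ Y ∈ controlled α W.path, ∀ Z ∈ controlled α W.path,
        N (mildMap W A F G N f R Y - mildMap W A F G N f R Z) ≤ C * (ε + R ^ 2) * N (Y - Z) := by
  obtain ⟨S, hS⟩ := exists_semigroupBound A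
  obtain ⟨L, hL⟩ := hf.exists_lipschitzOnWith
  set P : ℝ := b * (2 * S ^ 2 * (a * (L + 1))) with hP
  set Q : ℝ := 10 * roughIntegralConst α w c * (1 + w) ^ 2 * c' * a ^ 2 with hQ
  have hQ0 : 0 ≤ Q := by
    have := (roughIntegralConst_pos hα w c).le
    positivity
  refine ⟨|P| * (1 + Q), by positivity, fun R ε hR hε Y hY Z hZ => ?_⟩
  have hYZ : ControlledWith (a * ((L + 1) * N (Y - Z))) α W.path
      (cutoff N f R Y - cutoff N f R Z) :=
    (h.bound _ (sub_mem_controlled (cutoff_mem_controlled N f R hY)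
      (cutoff_mem_controlled N f R hZ))).mono
      (mul_le_mul_of_nonneg_left (h.map_cutoff_sub_le hf hL hR hY hZ) h.pos.le)
  have hfactor : P * (ε + Q * R ^ 2) ≤ |P| * ((1 + Q) * (ε + R ^ 2)) := by
    refine mul_le_mul (le_abs_self P) ?_ (by positivity) (abs_nonneg P)
    nlinarith [mul_nonneg hQ0 ε.coe_nonneg, sq_nonneg R]
  rw [mildMap_eq_convPair, mildMap_eq_convPair]
  refine (h.le _ _ (controlledWith_convPair_comp_sub hα hα' hW hS hF hε hG
    (h.controlledWith_cutoff hf hR hY) (h.controlledWith_cutoff hf hR hZ) hYZ)).trans ?_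
  calc _ = P * (ε + Q * R ^ 2) * N (Y - Z) := by rw [hP, hQ]; ring
    _ ≤ |P| * (1 + Q) * (ε + R ^ 2) * N (Y - Z) := by
      rw [mul_assoc |P|]
      exact mul_le_mul_of_nonneg_right hfactor (h.nonneg (sub_mem_controlled hY hZ))

theorem exists_mildMap_contraction (h : IsControlledNorm a b α W.path N) (hα : (1 : ℝ) < 3 * α)
    (hα' : (α : ℝ) ≤ 1 / 2) (hW : W.BoundedBy X w c) (A : X →L[ℝ] X) (hF : Continuous F)
    (hF0 : HasStrictFDerivAt F (0 : X →L[ℝ] X) 0) (hG : CubicAtZero c' G) (hf : IsCutoff f)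
    {K : ℝ} (hK : 0 < K) :
    ∃ R₀ : ℝ, 0 < R₀ ∧ ∀ R : ℝ, 0 < R → R ≤ R₀ →
      ∀ Y ∈ controlled α W.path, ∀ Z ∈ controlled α W.path,
        N (mildMap W A F G N f R Y - mildMap W A F G N f R Z) ≤ K * N (Y - Z) := by
  obtain ⟨C, hC, hle⟩ := exists_mildMap_sub_le h hα hα' hW A hF hG hf
  obtain ⟨ε, hε, hCε⟩ : ∃ ε : ℝ≥0, 0 < ε ∧ C * (ε + ε) ≤ K := by
    have hpos : 0 < K / (2 * (C + 1)) := by positivity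
    refine ⟨⟨K / (2 * (C + 1)), hpos.le⟩, hpos, ?_⟩
    change C * (K / (2 * (C + 1)) + K / (2 * (C + 1))) ≤ K
    have : C / (C + 1) ≤ 1 := (div_le_one (by positivity)).2 (by linarith)
    calc _ = C / (C + 1) * K := by field_simp; ring
      _ ≤ K := mul_le_of_le_one_left hK.le this
  obtain ⟨s, hs, hεs⟩ := hF0.exists_lipschitzOnWith_of_nnnorm_lt ε (by simpa using hε)
  obtain ⟨ρ, hρ, hρs⟩ := Metric.nhds_basis_closedBall.mem_iff.1 hs
  refine ⟨min (ρ / a) (min 1 ε), lt_min (div_pos hρ h.pos) (lt_min one_pos hε),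
    fun R hR hRle Y hY Z hZ => ?_⟩
  obtain ⟨hRρ, hR1, hRε⟩ := by simpa only [le_min_iff] using hRle
  have hball : LipschitzOnWith ε F (Metric.closedBall 0 (a * R)) :=
    hεs.mono ((Metric.closedBall_subset_closedBall ((le_div_iff₀' h.pos).1 hRρ)).trans hρs)
  refine (hle R ε hR hball Y hY Z hZ).trans
    (mul_le_mul_of_nonneg_right ?_ (h.nonneg (sub_mem_controlled hY hZ)))
  refine (mul_le_mul_of_nonneg_left ?_ hC).trans hCε
  nlinarith

end MildMap

end RoughCutoff

end

open RoughCutoff in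
theorem mainTheorem4_general
    {V X : Type*} [NormedAddCommGroup V] [InnerProductSpace ℝ V]
    [NormedAddCommGroup X] [NormedSpace ℝ X] [CompleteSpace X]
    {α w c c' : ℝ≥0} (hα : (1 / 3 : ℝ) < α) (hα' : (α : ℝ) ≤ 1 / 2)
    {W : RoughPath α V} (hW : W.BoundedBy X w c) (A : X →L[ℝ] X)
    {F : X → X} (hF : Continuous F) (hF0 : HasStrictFDerivAt F (0 : X →L[ℝ] X) 0)
    {G : X → V →L[ℝ] X} (hG : CubicAtZero c' G) {f : ℝ → ℝ} (hf : IsCutoff f)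
    {N : PathPair V X → ℝ} {a b : ℝ} (hN : IsControlledNorm a b α W.path N) :
    (∀ R : ℝ, 0 < R → ∀ Y ∈ controlled (X := X) α W.path,
      (∀ t : I, IntervalIntegrable (driftIntegrand A F (cutoff N f R Y).1 t)
        MeasureTheory.volume 0 t) ∧
      (∀ t : I, shifted A t (compose G (cutoff N f R Y)) ∈ controlled (X := V →L[ℝ] X) α W.path ∧
        ∃ J : X, IsRoughIntegral W (shifted A t (compose G (cutoff N f R Y))) 0 t J) ∧
      mildMap W A F G N f R Y ∈ controlled (X := X) α W.path) ∧
    ∃ R₀ : ℝ, 0 < R₀ ∧ ∀ R : ℝ, 0 < R → R ≤ R₀ →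
      (∃ K : ℝ, 0 ≤ K ∧ K < 1 ∧
        ∀ Y ∈ controlled (X := X) α W.path, ∀ Z ∈ controlled (X := X) α W.path,
          N (mildMap W A F G N f R Y - mildMap W A F G N f R Z) ≤ K * N (Y - Z)) ∧
      (∃! Y : PathPair V X, Y ∈ controlled α W.path ∧ mildMap W A F G N f R Y = Y) ∧
      (∀ ξ : X, ∃! U : PathPair V X,
        U ∈ controlled α W.path ∧ U = initialPair A ξ + mildMap W A F G N f R U) := by
  have hα3 : (1 : ℝ) < 3 * α := by linarith
  have hα0 : 0 < α := by exact_mod_cast (by linarith : (0 : ℝ) < α)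
  obtain ⟨S, hS⟩ := exists_semigroupBound A
  have hmem (R : ℝ) (Y : PathPair V X) (hY : Y ∈ controlled α W.path) :=
    mildMap_mem_controlled hN hα3 hα' hW A hF hG f R hY
  refine ⟨fun R _ Y hY => ⟨fun t => ?_, fun t => ?_, hmem R Y hY⟩, ?_⟩
  · exact (continuous_driftIntegrand A (hF.comp (continuous_of_mem_controlled hα0
      (cutoff_mem_controlled N f R hY))) t).intervalIntegrable _ _
  · obtain ⟨M, hM⟩ := exists_controlledWith_compose_cutoff hN hG hW.path f R hY
    exact ⟨(hS.controlledWith_shifted hα' hM t).mem_controlled hW.path,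
      _, isRoughIntegral_roughConv hα3 hα' hW hS hM t⟩
  obtain ⟨R₀, hR₀, hcontr⟩ := exists_mildMap_contraction hN hα3 hα' hW A hF hF0 hG hf one_half_pos
  refine ⟨R₀, hR₀, fun R hR hRle => ⟨⟨1 / 2, by norm_num, by norm_num, hcontr R hR hRle⟩,
    hN.existsUnique_fixedPoint hW.path _ (hmem R) one_half_pos.le one_half_lt_one
      (hcontr R hR hRle), fun ξ => ?_⟩⟩
  simp only [eq_comm (b := initialPair A ξ + _)]
  refine hN.existsUnique_fixedPoint hW.path (fun U => initialPair A ξ + mildMap W A F G N f R U)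
    (fun Y hY => add_mem_controlled ((hS.controlledWith_initialPair hα' _ ξ).mem_controlled
      hW.path) (hmem R Y hY)) one_half_pos.le one_half_lt_one fun Y hY Z hZ => ?_
  rw [add_sub_add_left_eq_sub]
  exact hcontr R hR hRle Y hY Z hZ

theorem mainTheorem4
    {V X : Type*}
    [NormedAddCommGroup V] [InnerProductSpace ℝ V] [FiniteDimensional ℝ V]
    [NormedAddCommGroup X] [NormedSpace ℝ X] [FiniteDimensional ℝ X]
    (α : ℝ≥0) (hα : (1 / 3 : ℝ) < α) (hα' : (α : ℝ) ≤ 1 / 2)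
    (W : RoughCutoff.RoughPath α V) (A : X →L[ℝ] X)
    (F : X → X) (hF : RoughCutoff.BoundedDerivs 1 F) (hF0 : F 0 = 0) (hF1 : fderiv ℝ F 0 = 0)
    (G : X → V →L[ℝ] X) (hG : RoughCutoff.BoundedDerivs 3 G) (hG0 : G 0 = 0)
    (hG1 : fderiv ℝ G 0 = 0) (hG2 : fderiv ℝ (fderiv ℝ G) 0 = 0)
    (f : ℝ → ℝ) (hf : RoughCutoff.IsCutoff f)
    -- `N` is either of the two norms on controlled rough paths
    (N : RoughCutoff.PathPair V X → ℝ)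
    (hN : N = RoughCutoff.crpNorm α W.path ∨ N = RoughCutoff.crpSupNorm α W.path) :
    -- for every `R > 0` all the integrals exist and `T_R` maps `D^{2α}_W` into itself
    (∀ R : ℝ, 0 < R → ∀ Y ∈ RoughCutoff.controlled (X := X) α W.path,
      (∀ t : I, IntervalIntegrable
        (RoughCutoff.driftIntegrand A F (RoughCutoff.cutoff N f R Y).1 t)
        MeasureTheory.volume 0 t) ∧
      (∀ t : I,
        RoughCutoff.shifted A t (RoughCutoff.compose G (RoughCutoff.cutoff N f R Y)) ∈
          RoughCutoff.controlled (X := V →L[ℝ] X) α W.path ∧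
        ∃ J : X, RoughCutoff.IsRoughIntegral W
          (RoughCutoff.shifted A t (RoughCutoff.compose G (RoughCutoff.cutoff N f R Y))) 0 t J) ∧
      RoughCutoff.mildMap W A F G N f R Y ∈ RoughCutoff.controlled (X := X) α W.path) ∧
    -- for every small `R` ...
    ∃ R₀ : ℝ, 0 < R₀ ∧ ∀ R : ℝ, 0 < R → R ≤ R₀ →
      -- ... `T_R` is a contraction,
      (∃ K : ℝ, 0 ≤ K ∧ K < 1 ∧
        ∀ Y ∈ RoughCutoff.controlled (X := X) α W.path,
        ∀ Z ∈ RoughCutoff.controlled (X := X) α W.path,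
          N (RoughCutoff.mildMap W A F G N f R Y - RoughCutoff.mildMap W A F G N f R Z)
            ≤ K * N (Y - Z)) ∧
      -- it has a unique fixed point,
      (∃! Y : RoughCutoff.PathPair V X,
        Y ∈ RoughCutoff.controlled α W.path ∧ RoughCutoff.mildMap W A F G N f R Y = Y) ∧
      -- and the truncated equation has a unique solution for every initial value
      (∀ ξ : X, ∃! U : RoughCutoff.PathPair V X,
        U ∈ RoughCutoff.controlled α W.path ∧
        U = RoughCutoff.initialPair A ξ + RoughCutoff.mildMap W A F G N f R U) := by
  have : CompleteSpace X := FiniteDimensional.complete ℝ X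
  have hα0 : 0 < α := by exact_mod_cast (by linarith : (0 : ℝ) < α)
  obtain ⟨w, c, hW⟩ := RoughCutoff.RoughPath.exists_boundedBy X W
  obtain ⟨c', hG'⟩ := hG.exists_cubicAtZero hG0 hG1 hG2
  have hF0 : HasStrictFDerivAt F (0 : X →L[ℝ] X) 0 :=
    hF1 ▸ hF.1.contDiffAt.hasStrictFDerivAt (by norm_num)
  rcases hN with rfl | rfl
  · exact mainTheorem4_general hα hα' hW A hF.1.continuous hF0 hG' hf
      (RoughCutoff.isControlledNorm_crpNorm hα0 hW.path)
  · exact mainTheorem4_general hα hα' hW A hF.1.continuous hF0 hG' hf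
      (RoughCutoff.isControlledNorm_crpSupNorm hα0)
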